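/- **Setting.** Let $\mathbb F_q$ be a finite field with $q$ elements, $\theta$ and $t$ independent variables, $A=\mathbb F_q[\theta]$, $k=\mathbb F_q(\theta)$, $k_\infty=\mathbb F_q((1/\theta))$, $\mathbb C_\infty$ the completion of an algebraic closure $\overline{k_\infty}$, and $\overline k$ the algebraic closure of $k$ in $\overline{k_\infty}$. Let $\mathbb T$ be the Tate algebra of all $\sum a_it^i\in\mathbb C_\infty[[t]]$ with $a_i\to 0$, and $\mathbb L$ its fraction field. For $n\in\mathbb Z$ and $f=\sum a_it^i$ put $f^{(n)}=\sum a_i^{q^n}t^i$, and let $\mathbb C_\infty[\tau]$ be the ring of twisted polynomials, $\tau c=c^q\tau$. Let $\rho:\mathbb F_q[t]\to\mathbb C_\infty[\tau]$ be a Drinfeld $\mathbb F_q[t]$-module of rank $r$, i.e. an $\mathbb F_q$-algebra homomorphism, with image not contained in $\mathbb C_\infty$, such that $\rho_a$ has constant term $a(\theta)$; write $\rho_t=\theta+\kappa_1\tau+\cdots+\kappa_r\tau^r$ with $\kappa_r\neq0$, and $\kappa_n=0$ for $n>r$. Let $\exp_\rho(z)=z+\sum_{n\ge1}\alpha_nz^{q^n}$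 be its exponential function, determined by $\exp_\rho(\theta z)=\rho_t(\exp_\rho(z))$, let $\Lambda_\rho=\ker\exp_\rho$, and fix an $A$-basis $\omega_1,\dots,\omega_r$ of $\Lambda_\rho$. Put $$f_i=\sum_{m\ge0}\exp_\rho\Bigl(\frac{\omega_i}{\theta^{m+1}}\Bigr)t^m\in\mathbb T,\qquad \Upsilon=\bigl(f_i^{(j-1)}\bigr)_{1\le i,j\le r},\qquad V=\bigl(\kappa_{i+j-1}^{(-(j-1))}\bigr)_{1\le i,j\le r},$$ and $\Psi_\rho=V^{-1}[\Upsilon^{(1)}]^{-1}\in\mathrm{GL}_r(\mathbb L)$. Let $Z_{\Psi_\rho}$ be the smallest closed subscheme of $\mathrm{GL}_r/\overline k(t)$ having $\Psi_\rho$ as an $\mathbb L$-valued point, and $\Gamma_{\Psi_\rho}$ the smallest closed subscheme of $\mathrm{GL}_r/\mathbb F_q(t)$ with $\Gamma_{\Psi_\rho}(\overline{\mathbb L})\supseteq\Psi_\rho^{-1}Z_{\Psi_\rho}(\overline{\mathbb L})$. If $\rho$ is defined over a field $K$ with $k\subseteq K\subseteq\overline k$ (that is, $\rho(\mathbb F_q[t])\subseteq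 K[\tau]$), let $K^{\mathrm{sep}}$ be the separable closure of $K$ in $\overline k$. The group $\mathrm{Gal}(K^{\mathrm{sep}}/K)$ acts on the torsion modules $\rho[t^m]=\{x\in\mathbb C_\infty:\rho_{t^m}(x)=0\}\subseteq K^{\mathrm{sep}}$ and on $T_t(\rho)=\varprojlim\rho[t^m]$, which is free over $\mathbb F_q[[t]]$ with basis $x_i=(\exp_\rho(\omega_i/\theta^{m+1}))_{m\ge0}$, $1\le i\le r$. This gives the $t$-adic representation $\varphi_t$; for $\epsilon\in\mathrm{Gal}(K^{\mathrm{sep}}/K)$ write $\varphi_t(\epsilon)x_i=\sum_j(g_\epsilon)_{ij}x_j$ with $g_\epsilon\in\mathrm{GL}_r(\mathbb F_q[[t]])$, and identify $\varphi_t(\epsilon)$ with $g_\epsilon$. **Theorem.** Let $K\subseteq\overline k$ be a finite extension of $k$ such that $\rho$ is defined over $K$, $\mathrm{End}(\rho)=\{b\in\mathbb C_\infty[\tau]: b\rho_a=\rho_ab\text{ for all }a\in\mathbb F_q[t]\}$ is contained in $K[\tau]$, and $Z_{\Psi_\rho}$ is defined over $K(t)$. Then $$\varphi_t\bigl(\mathrm{Gal}(K^{\mathrm{sep}}/K)\bigr)\subseteq\Gamma_{\Psi_\rho}\bigl(\mathbb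 F_q((t))\bigr),$$ i.e. $g_\epsilon\in\Gamma_{\Psi_\rho}(\mathbb F_q((t)))$ for every $\epsilon\in\mathrm{Gal}(K^{\mathrm{sep}}/K)$. -/

import Mathlib

noncomputable section
/-- `k_∞ = F_q((1/θ))`, the completion of `k = F_q(θ)` at the place at infinity. -/
abbrev KInfty (Fq : Type*) [Field Fq] : Type _ :=
  @RatFunc.CompletionAtInfty Fq _ (Classical.decEq _)

namespace KInfty

variable (Fq : Type*) [Field Fq]

theorem valued_theta :
    Valued.v (algebraMap (RatFunc Fq) (KInfty Fq) RatFunc.X) = WithZero.exp (1 : ℤ) := by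
  let : DecidableEq (RatFunc Fq) := Classical.decEq _
  refine (RatFunc.valuedCompletionAtInfty.def Fq).trans ?_
  let := RatFunc.inftyValued Fq
  refine (Valued.extensionValuation_apply_coe (K := RatFunc Fq) (RatFunc.X : RatFunc Fq)).trans ?_
  refine (RatFunc.inftyValued.def Fq).trans ?_
  exact RatFunc.inftyValuation.X Fq

variable [Fintype Fq]

/-- The absolute value on `k_∞` is normalised by `|θ| = q`. -/
instance rankOne : (Valued.v : Valuation (KInfty Fq) (WithZero (Multiplicative ℤ))).RankOne where
  hom' := (WithZeroMulInt.toNNReal (e := (Fintype.card Fq : NNReal)) (by simp)).comp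
    MonoidWithZeroHom.ValueGroup₀.embedding
  strictMono' := (WithZeroMulInt.toNNReal_strictMono (by
    exact_mod_cast Fintype.one_lt_card (α := Fq))).comp
      MonoidWithZeroHom.ValueGroup₀.embedding_strictMono
  exists_val_nontrivial := ⟨algebraMap (RatFunc Fq) (KInfty Fq) RatFunc.X, by
    rw [valued_theta]; simp⟩

instance : NontriviallyNormedField (KInfty Fq) := Valued.toNontriviallyNormedField _ _

instance : IsUltrametricDist (KInfty Fq) := Valued.instIsUltrametricDist _ _

instance : CompleteSpace (KInfty Fq) := by
  let : DecidableEq (RatFunc Fq) := Classical.decEq _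
  let := RatFunc.inftyValued Fq
  exact inferInstanceAs (CompleteSpace (UniformSpace.Completion (RatFunc Fq)))

theorem one_lt_norm_theta :
    1 < ‖algebraMap (RatFunc Fq) (KInfty Fq) RatFunc.X‖ := by
  rw [Valued.toNormedField.one_lt_norm_iff, valued_theta]
  exact WithZero.exp_lt_exp.mpr Int.one_pos

end KInfty

/-- `\overline{k_∞}`, with the absolute value extending that of `k_∞`. -/
abbrev KInftyBar (Fq : Type*) [Field Fq] : Type _ := AlgebraicClosure (KInfty Fq)

instance (Fq : Type*) [Field Fq] [Fintype Fq] : NormedField (KInftyBar Fq) :=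
  spectralNorm.normedField (KInfty Fq) (KInftyBar Fq)

instance (Fq : Type*) [Field Fq] [Fintype Fq] : NormedAlgebra (KInfty Fq) (KInftyBar Fq) :=
  spectralNorm.normedAlgebra (KInfty Fq) (KInftyBar Fq)

/-- `ℂ_∞`, the completion of `\overline{k_∞}`. -/
def CInfty (Fq : Type*) [Field Fq] [Fintype Fq] : Type _ :=
  UniformSpace.Completion (KInftyBar Fq)

/-- The algebraic closure `\overline k` of `k = F_q(θ)` in `\overline{k_∞}`. -/
abbrev KBar (Fq : Type*) [Field Fq] : IntermediateField (RatFunc Fq) (KInftyBar Fq) :=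
  algebraicClosure (RatFunc Fq) (KInftyBar Fq)

namespace CInfty

variable (Fq : Type*) [Field Fq] [Fintype Fq]

instance : NormedField (CInfty Fq) :=
  inferInstanceAs (NormedField (UniformSpace.Completion (KInftyBar Fq)))

instance : CompleteSpace (CInfty Fq) :=
  inferInstanceAs (CompleteSpace (UniformSpace.Completion (KInftyBar Fq)))

/-- The embedding `\overline{k_∞} ⊆ ℂ_∞`. -/
def ofBar : KInftyBar Fq →+* CInfty Fq :=
  (UniformSpace.Completion.coeRingHom : KInftyBar Fq →+* UniformSpace.Completion (KInftyBar Fq))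

theorem norm_ofBar (x : KInftyBar Fq) : ‖ofBar Fq x‖ = ‖x‖ :=
  UniformSpace.Completion.norm_coe x

theorem denseRange_ofBar : DenseRange (ofBar Fq) :=
  UniformSpace.Completion.denseRange_coe

instance : IsUltrametricDist (KInftyBar Fq) :=
  IsUltrametricDist.of_normedAlgebra (KInfty Fq)

instance : IsUltrametricDist (CInfty Fq) := by
  refine IsUltrametricDist.isUltrametricDist_of_forall_norm_add_le_max_norm fun x y => ?_
  refine (denseRange_ofBar Fq).induction_on₂ (p := fun x y => ‖x + y‖ ≤ max ‖x‖ ‖y‖) ?_ ?_ x y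
  · exact isClosed_le (by fun_prop) (by fun_prop)
  · intro a b
    rw [← map_add, norm_ofBar, norm_ofBar, norm_ofBar]
    exact IsUltrametricDist.norm_add_le_max a b

instance : Algebra (RatFunc Fq) (CInfty Fq) :=
  ((ofBar Fq).comp (algebraMap (RatFunc Fq) (KInftyBar Fq))).toAlgebra

/-- `A = F_q[θ]` acts on `ℂ_∞` through `A ⊆ k ⊆ ℂ_∞`. -/
instance : Algebra (Polynomial Fq) (CInfty Fq) :=
  ((algebraMap (RatFunc Fq) (CInfty Fq)).comp
    (algebraMap (Polynomial Fq) (RatFunc Fq))).toAlgebra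

instance : Algebra Fq (CInfty Fq) :=
  ((algebraMap (RatFunc Fq) (CInfty Fq)).comp RatFunc.C).toAlgebra

instance : Algebra (KBar Fq) (CInfty Fq) :=
  ((ofBar Fq).comp (algebraMap (KBar Fq) (KInftyBar Fq))).toAlgebra

/-- The element `θ` of `ℂ_∞`. -/
def theta : CInfty Fq := algebraMap (RatFunc Fq) (CInfty Fq) RatFunc.X

theorem one_lt_norm_theta : 1 < ‖theta Fq‖ := by
  have : theta Fq = ofBar Fq (algebraMap (KInfty Fq) (KInftyBar Fq)
      (algebraMap (RatFunc Fq) (KInfty Fq) RatFunc.X)) := by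
    change ofBar Fq (algebraMap (RatFunc Fq) (KInftyBar Fq) _) = _
    rw [IsScalarTower.algebraMap_apply (RatFunc Fq) (KInfty Fq) (KInftyBar Fq)]
  rw [this, norm_ofBar, norm_algebraMap']
  exact KInfty.one_lt_norm_theta Fq

/-- The `q`-power Frobenius of `ℂ_∞`. -/
def frob : CInfty Fq →+* CInfty Fq :=
  (FiniteField.frobeniusAlgHom Fq (CInfty Fq) : CInfty Fq →+* CInfty Fq)

theorem frob_apply (x : CInfty Fq) : frob Fq x = x ^ Fintype.card Fq := rfl

theorem frob_bijective : Function.Bijective (frob Fq) := by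
  refine ⟨(frob Fq).injective, ?_⟩
  have hq : Fintype.card Fq ≠ 0 := Fintype.card_ne_zero
  have hcl : IsClosed (Set.range (frob Fq)) := by
    refine (IsUniformInducing.isComplete_range ?_).isClosed
    have hd : ∀ x y : CInfty Fq, dist (frob Fq x) (frob Fq y) = dist x y ^ Fintype.card Fq :=
      fun x y => by rw [dist_eq_norm, dist_eq_norm, ← map_sub, frob_apply, norm_pow]
    refine Metric.isUniformInducing_iff.mpr ⟨?_, fun δ hδ => ?_⟩
    · refine Metric.uniformContinuous_iff.mpr fun ε hε => ⟨min ε 1, by positivity, fun {a b} h => ?_⟩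
      rw [hd]
      exact (pow_le_of_le_one dist_nonneg (h.le.trans (min_le_right _ _)) hq).trans_lt
        (h.trans_le (min_le_left _ _))
    · refine ⟨δ ^ Fintype.card Fq, by positivity, fun {a b} h => ?_⟩
      rw [hd] at h
      exact lt_of_pow_lt_pow_left₀ _ hδ.le h
  have hd : DenseRange (frob Fq) := by
    refine (denseRange_ofBar Fq).mono ?_
    rintro _ ⟨x, rfl⟩
    obtain ⟨y, hy⟩ := IsAlgClosed.exists_pow_nat_eq x (Nat.pos_of_ne_zero hq)
    exact ⟨ofBar Fq y, by rw [frob_apply, ← map_pow, hy]⟩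
  intro x
  have h := hd x
  rwa [hcl.closure_eq] at h

/-- The `q`-power Frobenius of the perfect field `ℂ_∞`, as an automorphism. -/
def frobEquiv : CInfty Fq ≃+* CInfty Fq := RingEquiv.ofBijective (frob Fq) (frob_bijective Fq)

end CInfty

/-- `R[τ]` for `R = ℂ_∞`: here `τ` acts by the `q`-power Frobenius, so that `τ c = c ^ q τ`. -/
instance CInfty.instFrobAction (Fq : Type*) [Field Fq] [Fintype Fq] :
    MulSemiringAction (Multiplicative ℕ) (CInfty Fq) where
  smul n x := (CInfty.frob Fq ^ n.toAdd) x
  one_smul x := rfl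
  mul_smul m n x := by
    change (CInfty.frob Fq ^ (m.toAdd + n.toAdd)) x = _
    rw [pow_add]; rfl
  smul_zero n := map_zero (CInfty.frob Fq ^ n.toAdd)
  smul_add n := map_add (CInfty.frob Fq ^ n.toAdd)
  smul_one n := map_one (CInfty.frob Fq ^ n.toAdd)
  smul_mul n := map_mul (CInfty.frob Fq ^ n.toAdd)

namespace CInfty

variable {Fq : Type*} [Field Fq] [Fintype Fq]

theorem frob_pow_apply (n : ℕ) (x : CInfty Fq) :
    (frob Fq ^ n) x = x ^ (Fintype.card Fq) ^ n := by
  induction n generalizing x with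
  | zero => simp
  | succ n ih =>
    rw [pow_succ, RingHom.mul_def, RingHom.comp_apply, ih, frob_apply, ← pow_mul, pow_succ']

theorem smul_def (n : Multiplicative ℕ) (x : CInfty Fq) :
    n • x = x ^ (Fintype.card Fq) ^ n.toAdd := frob_pow_apply _ _

theorem add_pow_card_pow (n : ℕ) (x y : CInfty Fq) :
    (x + y) ^ (Fintype.card Fq) ^ n = x ^ (Fintype.card Fq) ^ n + y ^ (Fintype.card Fq) ^ n := by
  simp only [← frob_pow_apply, map_add]

theorem sum_pow_card_pow {ι : Type*} (s : Finset ι) (f : ι → CInfty Fq) (n : ℕ) :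
    (∑ i ∈ s, f i) ^ (Fintype.card Fq) ^ n = ∑ i ∈ s, f i ^ (Fintype.card Fq) ^ n := by
  simp only [← frob_pow_apply, map_sum]

theorem algebraMap_pow_card_pow (c : Fq) (n : ℕ) :
    algebraMap Fq (CInfty Fq) c ^ (Fintype.card Fq) ^ n = algebraMap Fq (CInfty Fq) c := by
  rw [← map_pow, FiniteField.pow_card_pow]

end CInfty

/-- The ring `ℂ_∞[τ]` of twisted polynomials. -/
abbrev TwistedPoly (Fq : Type*) [Field Fq] [Fintype Fq] := SkewPolynomial (CInfty Fq)

namespace TwistedPoly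

variable {Fq : Type*} [Field Fq] [Fintype Fq]

/-- The value `∑ c_n x ^ (q ^ n)` of the twisted polynomial `∑ c_n τ ^ n` at `x`. -/
def eval (f : TwistedPoly Fq) (x : CInfty Fq) : CInfty Fq :=
  SkewPolynomial.sum f fun n c => c * x ^ (Fintype.card Fq) ^ n

theorem eval_eq_sum_range (f : TwistedPoly Fq) (N : ℕ)
    (hN : ∀ n, N ≤ n → f.coeff n = 0) (x : CInfty Fq) :
    f.eval x = ∑ n ∈ Finset.range N, f.coeff n * x ^ (Fintype.card Fq) ^ n := by
  rw [eval, SkewPolynomial.sum_def]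
  refine Finset.sum_subset (fun n hn => ?_) (fun n _ hn => ?_)
  · rw [Finset.mem_range]
    by_contra h
    exact SkewPolynomial.mem_support_iff.mp hn (hN n (not_lt.mp h))
  · rw [SkewPolynomial.notMem_support_iff.mp hn, zero_mul]

theorem eval_monomial (n : ℕ) (c x : CInfty Fq) :
    eval (SkewPolynomial.monomial n c) x = c * x ^ (Fintype.card Fq) ^ n :=
  SkewPolynomial.sum_monomial_index (by simp)

theorem exists_bound (f : TwistedPoly Fq) : ∃ N, ∀ n, N ≤ n → f.coeff n = 0 := by
  refine ⟨f.support.sup id + 1, fun n hn => ?_⟩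
  by_contra h
  have := Finset.le_sup (f := id) (SkewPolynomial.mem_support_iff.mpr h)
  simp only [id] at this
  omega

theorem coeff_add (f g : TwistedPoly Fq) (n : ℕ) :
    SkewPolynomial.coeff (f + g) n = SkewPolynomial.coeff f n + SkewPolynomial.coeff g n := by
  simp [SkewPolynomial.coeff]

theorem eval_add (f g : TwistedPoly Fq) (x : CInfty Fq) :
    eval (f + g) x = eval f x + eval g x := by
  obtain ⟨N, hN⟩ := exists_bound f
  obtain ⟨M, hM⟩ := exists_bound g
  rw [eval_eq_sum_range f (max N M) (fun n h => hN n (by omega)),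
    eval_eq_sum_range g (max N M) (fun n h => hM n (by omega)),
    eval_eq_sum_range (f + g) (max N M) (fun n h => ?_), ← Finset.sum_add_distrib]
  · refine Finset.sum_congr rfl fun n _ => ?_
    rw [← add_mul, coeff_add]
  · rw [coeff_add, hN n (by omega), hM n (by omega), add_zero]

theorem eval_zero_left (x : CInfty Fq) : eval (0 : TwistedPoly Fq) x = 0 :=
  (eval_eq_sum_range _ 0 (fun _ _ => rfl) x).trans rfl

theorem eval_apply_add (f : TwistedPoly Fq) (x y : CInfty Fq) :
    eval f (x + y) = eval f x + eval f y := by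
  obtain ⟨N, hN⟩ := exists_bound f
  simp only [eval_eq_sum_range f N hN, CInfty.add_pow_card_pow, mul_add, Finset.sum_add_distrib]

/-- `eval f` is additive. -/
def evalAdd (f : TwistedPoly Fq) : CInfty Fq →+ CInfty Fq :=
  AddMonoidHom.mk' (eval f) (eval_apply_add f)

theorem eval_apply_zero (f : TwistedPoly Fq) : eval f 0 = 0 := map_zero (evalAdd f)

theorem eval_apply_sum (f : TwistedPoly Fq) {ι : Type*} (s : Finset ι) (x : ι → CInfty Fq) :
    eval f (∑ i ∈ s, x i) = ∑ i ∈ s, eval f (x i) := map_sum (evalAdd f) x s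

theorem eval_apply_const_mul (f : TwistedPoly Fq) (c : Fq) (x : CInfty Fq) :
    eval f (algebraMap Fq (CInfty Fq) c * x) = algebraMap Fq (CInfty Fq) c * eval f x := by
  obtain ⟨N, hN⟩ := exists_bound f
  simp only [eval_eq_sum_range f N hN, Finset.mul_sum, mul_pow,
    CInfty.algebraMap_pow_card_pow]
  exact Finset.sum_congr rfl fun n _ => by ring

theorem eval_mul (f g : TwistedPoly Fq) (x : CInfty Fq) :
    eval (f * g) x = eval f (eval g x) := by
  induction f using SkewPolynomial.induction with
  | h0 => rw [zero_mul, eval_zero_left, eval_zero_left]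
  | ha n r f _ _ ih =>
    rw [add_mul, eval_add, eval_add, ih]
    congr 1
    clear ih
    induction g using SkewPolynomial.induction with
    | h0 => rw [mul_zero, eval_zero_left, eval_apply_zero]
    | ha m s g _ _ ih =>
      rw [mul_add, eval_add, eval_add, eval_apply_add, ih]
      congr 1
      rw [SkewPolynomial.monomial_mul_monomial, SkewPolynomial.φ_iterate_apply, eval_monomial,
        eval_monomial, eval_monomial, CInfty.smul_def, mul_pow, ← pow_mul, ← pow_add]
      rw [toAdd_ofAdd, add_comm m n]
      ring

theorem eval_C (c x : CInfty Fq) : eval (SkewPolynomial.C c) x = c * x := by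
  rw [← SkewPolynomial.monomial_zero_left, eval_monomial]; simp

end TwistedPoly

/-- A Drinfeld `F_q[t]`-module: an `F_q`-algebra homomorphism `ρ : F_q[t] → ℂ_∞[τ]` whose image is
not contained in `ℂ_∞`, and such that the constant term of `ρ_a` is `a(θ)`. -/
structure DrinfeldModule (Fq : Type*) [Field Fq] [Fintype Fq] where
  /-- the homomorphism `a ↦ ρ_a` -/
  toRingHom : Polynomial Fq →+* TwistedPoly Fq
  map_C : ∀ c : Fq, toRingHom (Polynomial.C c) = SkewPolynomial.C (algebraMap Fq (CInfty Fq) c)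
  coeff_zero : ∀ a : Polynomial Fq,
    (toRingHom a).coeff 0 = algebraMap (Polynomial Fq) (CInfty Fq) a
  not_const : ¬ ∀ a, ∃ c : CInfty Fq, toRingHom a = SkewPolynomial.C c

namespace DrinfeldModule

variable {Fq : Type*} [Field Fq] [Fintype Fq] (ρ : DrinfeldModule Fq)

/-- `ρ_t`. -/
def rhoT : TwistedPoly Fq := ρ.toRingHom Polynomial.X

/-- The coefficient `κ_n` in `ρ_t = θ + κ_1 τ + ⋯ + κ_r τ ^ r`. -/
def kappa (n : ℕ) : CInfty Fq := ρ.rhoT.coeff n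

/-- The rank of `ρ`: the degree `r` of `ρ_t` in `τ`. -/
def rank : ℕ := ρ.rhoT.support.sup id

theorem kappa_eq_zero {n : ℕ} (hn : ρ.rank < n) : ρ.kappa n = 0 := by
  by_contra h
  have : n ≤ ρ.rank := Finset.le_sup (f := id) (SkewPolynomial.mem_support_iff.mpr h)
  omega

theorem kappa_zero : ρ.kappa 0 = CInfty.theta Fq := by
  rw [kappa, rhoT, ρ.coeff_zero]
  change algebraMap (RatFunc Fq) (CInfty Fq) (algebraMap _ _ _) = _
  rw [RatFunc.algebraMap_X]; rfl

theorem theta_ne_zero : CInfty.theta Fq ≠ 0 := by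
  have := CInfty.one_lt_norm_theta Fq
  intro h
  rw [h, norm_zero] at this
  linarith

theorem kappa_rank_ne_zero : ρ.kappa ρ.rank ≠ 0 := by
  have h : ρ.rhoT.support.Nonempty :=
    ⟨0, SkewPolynomial.mem_support_iff.mpr (by
      rw [← kappa, kappa_zero]; exact theta_ne_zero)⟩
  obtain ⟨n, hn, h2⟩ := Finset.exists_mem_eq_sup _ h id
  have : ρ.rank = n := h2
  rw [this]
  exact SkewPolynomial.mem_support_iff.mp hn

theorem eval_rhoT (x : CInfty Fq) :
    ρ.rhoT.eval x =
      ∑ j ∈ Finset.range (ρ.rank + 1), ρ.kappa j * x ^ (Fintype.card Fq) ^ j :=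
  TwistedPoly.eval_eq_sum_range _ _ (fun _ h => ρ.kappa_eq_zero h) x

/-- The coefficients `α_n` of the exponential function `exp_ρ(z) = ∑ α_n z ^ (q ^ n)`. They are
determined by `α_0 = 1` and the functional equation `exp_ρ(θ z) = ρ_t(exp_ρ(z))`. -/
def expCoeff : ℕ → CInfty Fq
  | 0 => 1
  | n + 1 => (CInfty.theta Fq ^ (Fintype.card Fq) ^ (n + 1) - CInfty.theta Fq)⁻¹ *
      ∑ j : Fin (n + 1), ρ.kappa (n + 1 - j) * expCoeff j ^ (Fintype.card Fq) ^ (n + 1 - (j : ℕ))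

theorem norm_theta_pow_sub (n : ℕ) :
    ‖CInfty.theta Fq ^ (Fintype.card Fq) ^ (n + 1) - CInfty.theta Fq‖ =
      ‖CInfty.theta Fq‖ ^ (Fintype.card Fq) ^ (n + 1) := by
  have h1 := CInfty.one_lt_norm_theta Fq
  have hlt : ‖CInfty.theta Fq‖ < ‖CInfty.theta Fq ^ (Fintype.card Fq) ^ (n + 1)‖ := by
    rw [norm_pow]
    conv_lhs => rw [← pow_one ‖CInfty.theta Fq‖]
    exact pow_lt_pow_right₀ h1 (Nat.one_lt_pow (by omega) Fintype.one_lt_card)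
  rw [sub_eq_add_neg, IsUltrametricDist.norm_add_eq_max_of_norm_ne_norm (by
    rw [norm_neg]; exact hlt.ne'), norm_neg, max_eq_left hlt.le, norm_pow]

/-- The functional equation `exp_ρ(θ z) = ρ_t(exp_ρ(z))`, coefficient by coefficient. -/
theorem expCoeff_functional (n : ℕ) :
    CInfty.theta Fq ^ (Fintype.card Fq) ^ n * ρ.expCoeff n =
      ∑ j ∈ Finset.range (n + 1), ρ.kappa j * ρ.expCoeff (n - j) ^ (Fintype.card Fq) ^ j := by
  cases n with
  | zero => simp [expCoeff, kappa_zero]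
  | succ n =>
    have hne : CInfty.theta Fq ^ (Fintype.card Fq) ^ (n + 1) - CInfty.theta Fq ≠ 0 := by
      rw [← norm_ne_zero_iff, norm_theta_pow_sub]
      exact pow_ne_zero _ (norm_ne_zero_iff.mpr theta_ne_zero)
    rw [Finset.sum_range_succ']
    have : ∑ j ∈ Finset.range (n + 1),
        ρ.kappa (j + 1) * ρ.expCoeff (n + 1 - (j + 1)) ^ (Fintype.card Fq) ^ (j + 1) =
        (CInfty.theta Fq ^ (Fintype.card Fq) ^ (n + 1) - CInfty.theta Fq) *
          ρ.expCoeff (n + 1) := by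
      rw [expCoeff, mul_inv_cancel_left₀ hne, Finset.sum_fin_eq_sum_range,
        ← Finset.sum_range_reflect]
      refine Finset.sum_congr rfl fun j hj => ?_
      rw [Finset.mem_range] at hj
      rw [dif_pos hj]
      have e1 : n + 1 - 1 - j + 1 = n + 1 - j := by omega
      have e2 : n + 1 - (n + 1 - j) = j := by omega
      simp only [e1, e2]
    rw [this, kappa_zero]
    simp
    ring

end DrinfeldModule

namespace DrinfeldModule

open Filter Topology

variable {Fq : Type*} [Field Fq] [Fintype Fq] (ρ : DrinfeldModule Fq)

theorem exists_kappa_bound : ∃ B : ℝ, 1 ≤ B ∧ ∀ j, ‖ρ.kappa j‖ ≤ B := by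
  refine ⟨1 + ∑ j ∈ Finset.range (ρ.rank + 1), ‖ρ.kappa j‖, ?_, fun j => ?_⟩
  · have : 0 ≤ ∑ j ∈ Finset.range (ρ.rank + 1), ‖ρ.kappa j‖ :=
      Finset.sum_nonneg fun _ _ => norm_nonneg _
    linarith
  · by_cases h : j < ρ.rank + 1
    · have := Finset.single_le_sum (f := fun j => ‖ρ.kappa j‖) (fun _ _ => norm_nonneg _)
        (Finset.mem_range.mpr h)
      linarith
    · rw [ρ.kappa_eq_zero (by omega), norm_zero]
      have : 0 ≤ ∑ j ∈ Finset.range (ρ.rank + 1), ‖ρ.kappa j‖ :=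
        Finset.sum_nonneg fun _ _ => norm_nonneg _
      linarith

theorem norm_expCoeff_succ_le (n : ℕ) {D : ℝ} (hD : 0 ≤ D)
    (h : ∀ j, 1 ≤ j → j ≤ n + 1 → j ≤ ρ.rank →
      ‖ρ.kappa j‖ * ‖ρ.expCoeff (n + 1 - j)‖ ^ (Fintype.card Fq) ^ j ≤ D) :
    ‖CInfty.theta Fq‖ ^ (Fintype.card Fq) ^ (n + 1) * ‖ρ.expCoeff (n + 1)‖ ≤ D := by
  have h1 := norm_theta_pow_sub (Fq := Fq) n
  have hne : CInfty.theta Fq ^ (Fintype.card Fq) ^ (n + 1) - CInfty.theta Fq ≠ 0 := by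
    rw [← norm_ne_zero_iff, h1]
    exact pow_ne_zero _ (norm_ne_zero_iff.mpr theta_ne_zero)
  rw [← h1, ← norm_mul, expCoeff, mul_inv_cancel_left₀ hne]
  refine IsUltrametricDist.norm_sum_le_of_forall_le_of_nonneg hD fun j _ => ?_
  rw [norm_mul, norm_pow]
  have hj := j.2
  by_cases hr : n + 1 - (j : ℕ) ≤ ρ.rank
  · have := h (n + 1 - j) (by omega) (by omega) hr
    rwa [show n + 1 - (n + 1 - (j : ℕ)) = j by omega] at this
  · rw [ρ.kappa_eq_zero (by omega), norm_zero, zero_mul]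
    exact hD

theorem exists_le_pow {a : ℝ} (ha : 1 < a) (B : ℝ) :
    ∃ N, ∀ n, N ≤ n → B ≤ a ^ (Fintype.card Fq) ^ n := by
  obtain ⟨N, hN⟩ := pow_unbounded_of_one_lt B ha
  refine ⟨N, fun n hn => hN.le.trans (pow_le_pow_right₀ ha.le ?_)⟩
  exact hn.trans (Nat.lt_pow_self Fintype.one_lt_card).le

theorem exists_expCoeff_bound :
    ∃ c : ℝ, 1 ≤ c ∧ ∀ n, ‖ρ.expCoeff n‖ ≤ c ^ (Fintype.card Fq) ^ n := by
  obtain ⟨B, hB1, hB⟩ := ρ.exists_kappa_bound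
  obtain ⟨N, hN⟩ := exists_le_pow (Fq := Fq) (CInfty.one_lt_norm_theta Fq) B
  have hs : ∀ n, 0 ≤ ∑ j ∈ Finset.range n, ‖ρ.expCoeff j‖ := fun n =>
    Finset.sum_nonneg fun _ _ => norm_nonneg _
  refine ⟨1 + ∑ j ∈ Finset.range N, ‖ρ.expCoeff j‖, by linarith [hs N], fun n => ?_⟩
  set c := 1 + ∑ j ∈ Finset.range N, ‖ρ.expCoeff j‖ with hc
  have hc1 : 1 ≤ c := by linarith [hs N]
  induction n using Nat.strong_induction_on with
  | _ n ih =>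
    by_cases hn : n < N
    · have := Finset.single_le_sum (f := fun j => ‖ρ.expCoeff j‖) (fun _ _ => norm_nonneg _)
        (Finset.mem_range.mpr hn)
      refine le_trans ?_ (le_self_pow₀ hc1 (pow_ne_zero _ Fintype.card_ne_zero))
      linarith
    · cases n with
      | zero =>
        rw [expCoeff, norm_one]
        exact one_le_pow₀ hc1
      | succ n =>
        have hθ : 0 < ‖CInfty.theta Fq‖ ^ (Fintype.card Fq) ^ (n + 1) :=
          pow_pos (by linarith [CInfty.one_lt_norm_theta Fq]) _
        refine le_of_mul_le_mul_left ?_ hθ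
        refine ρ.norm_expCoeff_succ_le n (by positivity) fun j hj1 hj2 _ => ?_
        refine mul_le_mul ((hB j).trans (hN _ (by omega))) ?_ (by positivity) hθ.le
        calc ‖ρ.expCoeff (n + 1 - j)‖ ^ (Fintype.card Fq) ^ j
            ≤ (c ^ (Fintype.card Fq) ^ (n + 1 - j)) ^ (Fintype.card Fq) ^ j :=
              pow_le_pow_left₀ (norm_nonneg _) (ih _ (by omega)) _
          _ = c ^ (Fintype.card Fq) ^ (n + 1) := by
              rw [← pow_mul, ← pow_add, Nat.sub_add_cancel hj2]

theorem expCoeff_bound_step {s : ℝ} (hs0 : 0 < s) (hs : 1 < s * ‖CInfty.theta Fq‖) {c : ℝ}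
    (hc : 0 < c) (h : ∃ N, ∀ n, N ≤ n → ‖ρ.expCoeff n‖ ≤ c ^ (Fintype.card Fq) ^ n) :
    ∃ N, ∀ n, N ≤ n → ‖ρ.expCoeff n‖ ≤ (c * s) ^ (Fintype.card Fq) ^ n := by
  obtain ⟨N, hN⟩ := h
  obtain ⟨B, hB1, hB⟩ := ρ.exists_kappa_bound
  obtain ⟨M, hM⟩ := exists_le_pow (Fq := Fq) hs B
  refine ⟨N + M + ρ.rank + 1, fun n hn => ?_⟩
  obtain ⟨n, rfl⟩ : ∃ m, n = m + 1 := ⟨n - 1, by omega⟩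
  have hθ : 0 < ‖CInfty.theta Fq‖ ^ (Fintype.card Fq) ^ (n + 1) :=
    pow_pos (by linarith [CInfty.one_lt_norm_theta Fq]) _
  refine le_of_mul_le_mul_left ?_ hθ
  refine ρ.norm_expCoeff_succ_le n (by positivity) fun j hj1 hj2 hjr => ?_
  calc ‖ρ.kappa j‖ * ‖ρ.expCoeff (n + 1 - j)‖ ^ (Fintype.card Fq) ^ j
      ≤ (s * ‖CInfty.theta Fq‖) ^ (Fintype.card Fq) ^ (n + 1) *
          (c ^ (Fintype.card Fq) ^ (n + 1 - j)) ^ (Fintype.card Fq) ^ j := by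
        refine mul_le_mul ((hB j).trans (hM _ (by omega))) ?_ (by positivity) (by positivity)
        exact pow_le_pow_left₀ (norm_nonneg _) (hN _ (by omega)) _
    _ = ‖CInfty.theta Fq‖ ^ (Fintype.card Fq) ^ (n + 1) *
          (c * s) ^ (Fintype.card Fq) ^ (n + 1) := by
        rw [← pow_mul, ← pow_add, Nat.sub_add_cancel hj2, mul_pow, mul_pow]
        ring

theorem tendsto_exp_term (z : CInfty Fq) :
    Tendsto (fun n => ρ.expCoeff n * z ^ (Fintype.card Fq) ^ n) atTop (𝓝 0) := by
  obtain ⟨c, hc1, hc⟩ := ρ.exists_expCoeff_bound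
  have hθ := CInfty.one_lt_norm_theta Fq
  obtain ⟨s, hs1, hs2⟩ := exists_between (inv_lt_one_of_one_lt₀ hθ)
  have hs0 : 0 < s := lt_trans (by positivity) hs1
  have hsθ : 1 < s * ‖CInfty.theta Fq‖ := by
    rwa [inv_lt_iff_one_lt_mul₀ (by linarith)] at hs1
  have key : ∀ m : ℕ, ∃ N, ∀ n, N ≤ n →
      ‖ρ.expCoeff n‖ ≤ (c * s ^ m) ^ (Fintype.card Fq) ^ n := by
    intro m
    induction m with
    | zero => exact ⟨0, fun n _ => by simpa using hc n⟩
    | succ m ih =>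
      have := ρ.expCoeff_bound_step hs0 hsθ (by positivity) ih
      simpa only [pow_succ, mul_assoc] using this
  obtain ⟨m, hm⟩ : ∃ m, c * s ^ m * ‖z‖ < 1 / 2 := by
    have : Tendsto (fun m : ℕ => c * s ^ m * ‖z‖) atTop (𝓝 (c * 0 * ‖z‖)) :=
      ((tendsto_pow_atTop_nhds_zero_of_lt_one hs0.le hs2).const_mul c).mul_const _
    simp only [mul_zero, zero_mul] at this
    exact (this.eventually_lt_const (by norm_num)).exists
  obtain ⟨N, hN⟩ := key m
  refine squeeze_zero_norm' (a := fun n : ℕ => (1 / 2 : ℝ) ^ n) ?_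
    (tendsto_pow_atTop_nhds_zero_of_lt_one (by norm_num) (by norm_num))
  filter_upwards [eventually_ge_atTop N] with n hn
  rw [norm_mul, norm_pow]
  calc ‖ρ.expCoeff n‖ * ‖z‖ ^ (Fintype.card Fq) ^ n
      ≤ (c * s ^ m) ^ (Fintype.card Fq) ^ n * ‖z‖ ^ (Fintype.card Fq) ^ n := by
        gcongr; exact hN n hn
    _ = (c * s ^ m * ‖z‖) ^ (Fintype.card Fq) ^ n := (mul_pow _ _ _).symm
    _ ≤ (1 / 2) ^ (Fintype.card Fq) ^ n := pow_le_pow_left₀ (by positivity) hm.le _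
    _ ≤ (1 / 2) ^ n := pow_le_pow_of_le_one (by norm_num) (by norm_num)
        (Nat.lt_pow_self Fintype.one_lt_card).le

theorem summable_exp (z : CInfty Fq) :
    Summable fun n => ρ.expCoeff n * z ^ (Fintype.card Fq) ^ n := by
  refine NonarchimedeanAddGroup.summable_of_tendsto_cofinite_zero ?_
  rw [Nat.cofinite_eq_atTop]
  exact ρ.tendsto_exp_term z

/-- The exponential function `exp_ρ(z) = ∑ α_n z ^ (q ^ n)` of `ρ`. -/
def exp (z : CInfty Fq) : CInfty Fq :=
  ∑' n, ρ.expCoeff n * z ^ (Fintype.card Fq) ^ n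

theorem exp_add (x y : CInfty Fq) : ρ.exp (x + y) = ρ.exp x + ρ.exp y := by
  rw [exp, exp, exp, ← (ρ.summable_exp x).tsum_add (ρ.summable_exp y)]
  exact tsum_congr fun n => by rw [CInfty.add_pow_card_pow, mul_add]

theorem exp_zero : ρ.exp 0 = 0 := by
  have := ρ.exp_add 0 0
  simpa using this

theorem exp_const_mul (c : Fq) (x : CInfty Fq) :
    ρ.exp (algebraMap Fq (CInfty Fq) c * x) = algebraMap Fq (CInfty Fq) c * ρ.exp x := by
  rw [exp, exp, ← tsum_mul_left]
  exact tsum_congr fun n => by rw [mul_pow, CInfty.algebraMap_pow_card_pow]; ring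

theorem exp_sum {ι : Type*} (s : Finset ι) (x : ι → CInfty Fq) :
    ρ.exp (∑ i ∈ s, x i) = ∑ i ∈ s, ρ.exp (x i) :=
  map_sum (AddMonoidHom.mk' ρ.exp ρ.exp_add) x s

theorem exp_pow_card_pow (z : CInfty Fq) (j : ℕ) :
    HasSum (fun n => ρ.expCoeff n ^ (Fintype.card Fq) ^ j * z ^ (Fintype.card Fq) ^ (n + j))
      (ρ.exp z ^ (Fintype.card Fq) ^ j) := by
  have hc : Continuous ((CInfty.frob Fq ^ j : CInfty Fq →+* CInfty Fq) : CInfty Fq → CInfty Fq) := by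
    rw [funext (CInfty.frob_pow_apply j)]
    fun_prop
  have := (ρ.summable_exp z).hasSum.map (CInfty.frob Fq ^ j : CInfty Fq →+* CInfty Fq) hc
  rw [CInfty.frob_pow_apply] at this
  have e : (fun n => ρ.expCoeff n ^ (Fintype.card Fq) ^ j * z ^ (Fintype.card Fq) ^ (n + j)) =
      (CInfty.frob Fq ^ j : CInfty Fq →+* CInfty Fq) ∘
        fun n => ρ.expCoeff n * z ^ (Fintype.card Fq) ^ n := by
    funext n
    rw [Function.comp_apply, CInfty.frob_pow_apply, mul_pow, ← pow_mul, pow_add]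
  rw [e]
  exact this

/-- `exp_ρ(θ z) = ρ_t(exp_ρ(z))`. -/
theorem exp_theta_mul (z : CInfty Fq) : ρ.exp (CInfty.theta Fq * z) = ρ.rhoT.eval (ρ.exp z) := by
  let g : ℕ → ℕ → CInfty Fq := fun j n =>
    if j ≤ n then
      ρ.kappa j * (ρ.expCoeff (n - j) ^ (Fintype.card Fq) ^ j * z ^ (Fintype.card Fq) ^ n) else 0
  have hg : ∀ j, HasSum (g j) (ρ.kappa j * ρ.exp z ^ (Fintype.card Fq) ^ j) := by
    intro j
    have h1 := (ρ.exp_pow_card_pow z j).mul_left (ρ.kappa j)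
    have h2 := (hasSum_nat_add_iff (f := g j) j (g := ρ.kappa j * ρ.exp z ^ (Fintype.card Fq) ^ j)).mp
      (by simpa [g] using h1)
    have h3 : ∑ i ∈ Finset.range j, g j i = 0 := Finset.sum_eq_zero fun i hi => by
      rw [Finset.mem_range] at hi
      simp [g, hi]
    rwa [h3, add_zero] at h2
  have hsum := hasSum_sum (s := Finset.range (ρ.rank + 1)) fun j _ => hg j
  rw [ρ.eval_rhoT, exp, ← hsum.tsum_eq]
  refine tsum_congr fun n => ?_
  have h1 : ∑ j ∈ Finset.range (ρ.rank + 1), g j n =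
      ∑ j ∈ Finset.range (ρ.rank + 1 + (n + 1)), g j n := by
    refine Finset.sum_subset (Finset.range_mono (by omega)) fun j _ hj => ?_
    rw [Finset.mem_range, not_lt] at hj
    simp [g, ρ.kappa_eq_zero (show ρ.rank < j by omega)]
  have h2 : ∑ j ∈ Finset.range (n + 1), g j n =
      ∑ j ∈ Finset.range (ρ.rank + 1 + (n + 1)), g j n := by
    refine Finset.sum_subset (Finset.range_mono (by omega)) fun j _ hj => ?_
    rw [Finset.mem_range, not_lt] at hj
    simp [g, show ¬ j ≤ n by omega]
  rw [h1, ← h2, mul_pow, ← mul_assoc, mul_comm (ρ.expCoeff n), ρ.expCoeff_functional,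
    Finset.sum_mul]
  refine Finset.sum_congr rfl fun j hj => ?_
  rw [Finset.mem_range] at hj
  simp [g, show j ≤ n by omega, mul_assoc]

theorem algebraMap_C (c : Fq) :
    algebraMap (Polynomial Fq) (CInfty Fq) (Polynomial.C c) = algebraMap Fq (CInfty Fq) c := by
  change algebraMap (RatFunc Fq) (CInfty Fq) (algebraMap _ _ _) = _
  rw [RatFunc.algebraMap_C]; rfl

theorem algebraMap_X :
    algebraMap (Polynomial Fq) (CInfty Fq) Polynomial.X = CInfty.theta Fq := by
  change algebraMap (RatFunc Fq) (CInfty Fq) (algebraMap _ _ _) = _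
  rw [RatFunc.algebraMap_X]; rfl

/-- `exp_ρ(a(θ) z) = ρ_a(exp_ρ(z))`. -/
theorem exp_algebraMap_mul (a : Polynomial Fq) (z : CInfty Fq) :
    ρ.exp (algebraMap (Polynomial Fq) (CInfty Fq) a * z) = (ρ.toRingHom a).eval (ρ.exp z) := by
  induction a using Polynomial.induction_on generalizing z with
  | add a b ha hb => rw [map_add, add_mul, exp_add, ha, hb, map_add, TwistedPoly.eval_add]
  | C c => rw [ρ.map_C, TwistedPoly.eval_C, algebraMap_C, exp_const_mul]
  | monomial n c ih =>
    rw [pow_succ, ← mul_assoc, map_mul, mul_assoc, ih, algebraMap_X, exp_theta_mul,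
      map_mul ρ.toRingHom (_ * _) Polynomial.X, TwistedPoly.eval_mul]
    rfl

/-- The period lattice `Λ_ρ`, the kernel of `exp_ρ`, as an `A`-submodule of `ℂ_∞`. -/
def periodLattice : Submodule (Polynomial Fq) (CInfty Fq) where
  carrier := {z | ρ.exp z = 0}
  add_mem' {x y} hx hy := by
    change ρ.exp (x + y) = 0
    rw [exp_add, show ρ.exp x = 0 from hx, show ρ.exp y = 0 from hy, add_zero]
  zero_mem' := ρ.exp_zero
  smul_mem' a z hz := by
    change ρ.exp (a • z) = 0
    rw [Algebra.smul_def, exp_algebraMap_mul, show ρ.exp z = 0 from hz,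
      TwistedPoly.eval_apply_zero]

theorem mem_periodLattice {z : CInfty Fq} : z ∈ ρ.periodLattice ↔ ρ.exp z = 0 := Iff.rfl

theorem norm_exp_le : ∃ c : ℝ, 1 ≤ c ∧ ∀ z : CInfty Fq, c * ‖z‖ ≤ 1 → ‖ρ.exp z‖ ≤ c * ‖z‖ := by
  obtain ⟨c, hc1, hc⟩ := ρ.exists_expCoeff_bound
  refine ⟨c, hc1, fun z hz => ?_⟩
  refine IsUltrametricDist.norm_tsum_le_of_forall_le_of_nonneg (by positivity) fun n => ?_
  rw [norm_mul, norm_pow]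
  calc ‖ρ.expCoeff n‖ * ‖z‖ ^ (Fintype.card Fq) ^ n
      ≤ c ^ (Fintype.card Fq) ^ n * ‖z‖ ^ (Fintype.card Fq) ^ n := by gcongr; exact hc n
    _ = (c * ‖z‖) ^ (Fintype.card Fq) ^ n := (mul_pow _ _ _).symm
    _ ≤ c * ‖z‖ := pow_le_of_le_one (by positivity) hz (pow_ne_zero _ Fintype.card_ne_zero)

/-- The division values `ξ_m = exp_ρ(ω / θ ^ (m + 1))` of a period `ω`. -/
def xi (ω : CInfty Fq) (m : ℕ) : CInfty Fq := ρ.exp (ω / CInfty.theta Fq ^ (m + 1))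

theorem tendsto_xi (ω : CInfty Fq) : Tendsto (ρ.xi ω) atTop (𝓝 0) := by
  obtain ⟨c, hc1, hc⟩ := ρ.norm_exp_le
  have hθ := CInfty.one_lt_norm_theta Fq
  have h1 : Tendsto (fun m : ℕ => c * ‖ω / CInfty.theta Fq ^ (m + 1)‖) atTop (𝓝 0) := by
    have h2 : Tendsto (fun m : ℕ => c * (‖ω‖ * (‖CInfty.theta Fq‖⁻¹) ^ (m + 1))) atTop
        (𝓝 (c * (‖ω‖ * 0))) :=
      (((tendsto_pow_atTop_nhds_zero_of_lt_one (by positivity)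
        (inv_lt_one_of_one_lt₀ hθ)).comp (tendsto_add_atTop_nat 1)).const_mul _).const_mul _
    simpa [div_eq_mul_inv] using h2
  refine squeeze_zero_norm' ?_ h1
  filter_upwards [h1.eventually_le_const one_pos] with m hm
  exact hc _ hm

theorem rhoT_xi_zero {ω : CInfty Fq} (hω : ω ∈ ρ.periodLattice) :
    ρ.rhoT.eval (ρ.xi ω 0) = 0 := by
  rw [xi, ← exp_theta_mul, zero_add, pow_one, mul_div_cancel₀ _ theta_ne_zero]
  exact hω

theorem rhoT_xi_succ (ω : CInfty Fq) (m : ℕ) :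
    ρ.rhoT.eval (ρ.xi ω (m + 1)) = ρ.xi ω m := by
  rw [xi, xi, ← exp_theta_mul]
  congr 1
  have := theta_ne_zero (Fq := Fq)
  field_simp
  ring

end DrinfeldModule

/-- The Tate algebra `𝕋` of power series over `ℂ_∞` converging on `|t| ≤ 1`, i.e. of those whose
coefficients tend to `0`. -/
def TateAlg (Fq : Type*) [Field Fq] [Fintype Fq] : Subring (PowerSeries (CInfty Fq)) where
  carrier := {f | Filter.Tendsto (fun n => PowerSeries.coeff n f) Filter.atTop (nhds 0)}
  mul_mem' {f g} hf hg := by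
    have key : ∀ f : PowerSeries (CInfty Fq), PowerSeries.IsRestricted 1 f ↔
        Filter.Tendsto (fun n => PowerSeries.coeff n f) Filter.atTop (nhds 0) := fun f => by
      rw [PowerSeries.isRestricted_iff', tendsto_zero_iff_norm_tendsto_zero (E := CInfty Fq)]
      simp
    exact (key _).mp (PowerSeries.isRestricted.mul 1 ((key f).mpr hf) ((key g).mpr hg))
  one_mem' := by
    refine tendsto_const_nhds.congr' ?_
    filter_upwards [Filter.eventually_ge_atTop 1] with n hn
    rw [PowerSeries.coeff_one, if_neg (by omega)]
  add_mem' {f g} hf hg := by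
    have := Filter.Tendsto.add hf hg
    simpa using this
  zero_mem' := by simp
  neg_mem' {f} hf := by
    have := Filter.Tendsto.neg hf
    simpa using this

/-- The fraction field `𝕃` of the Tate algebra. -/
abbrev LL (Fq : Type*) [Field Fq] [Fintype Fq] : Type _ := FractionRing (TateAlg Fq)

namespace TateAlg

variable {Fq : Type*} [Field Fq] [Fintype Fq]

theorem mem_iff {f : PowerSeries (CInfty Fq)} : f ∈ TateAlg Fq ↔
    Filter.Tendsto (fun n => PowerSeries.coeff n f) Filter.atTop (nhds 0) := Iff.rfl

theorem C_mem (c : CInfty Fq) : PowerSeries.C c ∈ TateAlg Fq := by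
  refine tendsto_const_nhds.congr' ?_
  filter_upwards [Filter.eventually_ge_atTop 1] with n hn
  rw [PowerSeries.coeff_C, if_neg (by omega)]

theorem X_mem : (PowerSeries.X : PowerSeries (CInfty Fq)) ∈ TateAlg Fq := by
  refine tendsto_const_nhds.congr' ?_
  filter_upwards [Filter.eventually_ge_atTop 2] with n hn
  rw [PowerSeries.coeff_X, if_neg (by omega)]

variable (Fq) in
/-- The constants `ℂ_∞ ⊆ 𝕋`. -/
def const : CInfty Fq →+* TateAlg Fq :=
  (PowerSeries.C : CInfty Fq →+* PowerSeries (CInfty Fq)).codRestrict (TateAlg Fq) C_mem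

/-- The variable `t` of `𝕋`. -/
def t : TateAlg Fq := ⟨PowerSeries.X, X_mem⟩

variable (Fq) in
/-- The `n`-fold twist `f = ∑ a_i t ^ i ↦ f^(n) = ∑ a_i ^ (q ^ n) t ^ i` of `𝕋`, for `n ≥ 0`. -/
def twist (n : ℕ) : TateAlg Fq →+* TateAlg Fq :=
  ((PowerSeries.map (CInfty.frob Fq ^ n)).comp (TateAlg Fq).subtype).codRestrict (TateAlg Fq) (by
    rintro ⟨f, hf⟩
    have hc : Continuous fun x : CInfty Fq => x ^ (Fintype.card Fq) ^ n := by fun_prop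
    have := (hc.tendsto 0).comp (mem_iff.mp hf)
    rw [zero_pow (pow_ne_zero _ Fintype.card_ne_zero)] at this
    refine this.congr fun m => ?_
    simp only [Function.comp_apply]
    exact (CInfty.frob_pow_apply n _).symm)

theorem constantCoeff_twist (n : ℕ) (f : TateAlg Fq) :
    PowerSeries.constantCoeff (twist Fq n f : PowerSeries (CInfty Fq)) =
      PowerSeries.constantCoeff (f : PowerSeries (CInfty Fq)) ^ (Fintype.card Fq) ^ n := by
  rw [← CInfty.frob_pow_apply, ← PowerSeries.coeff_zero_eq_constantCoeff_apply,
    ← PowerSeries.coeff_zero_eq_constantCoeff_apply]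
  change PowerSeries.coeff 0
    (PowerSeries.map (CInfty.frob Fq ^ n) (f : PowerSeries (CInfty Fq))) = _
  rw [PowerSeries.coeff_map]

/-- The inclusion `\overline{k}[t] ⊆ 𝕋`. -/
def ofPoly : Polynomial (KBar Fq) →+* TateAlg Fq :=
  Polynomial.eval₂RingHom ((const Fq).comp (algebraMap (KBar Fq) (CInfty Fq))) t

theorem coe_ofPoly (p : Polynomial (KBar Fq)) : (ofPoly p : PowerSeries (CInfty Fq)) =
    ((p.map (algebraMap (KBar Fq) (CInfty Fq)) : Polynomial (CInfty Fq)) :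
      PowerSeries (CInfty Fq)) := by
  have : (TateAlg Fq).subtype.comp ofPoly =
      (Polynomial.coeToPowerSeries.ringHom).comp
        (Polynomial.mapRingHom (algebraMap (KBar Fq) (CInfty Fq))) := by
    refine Polynomial.ringHom_ext (fun c => ?_) ?_
    · simp [ofPoly, const]
    · simp [ofPoly, t]
  exact RingHom.congr_fun this p

theorem ofPoly_injective : Function.Injective (ofPoly (Fq := Fq)) := by
  intro p q h
  have := congrArg (Subtype.val) h
  rw [coe_ofPoly, coe_ofPoly, Polynomial.coe_inj] at this
  exact Polynomial.map_injective _ (algebraMap (KBar Fq) (CInfty Fq)).injective this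

end TateAlg

/-- The homomorphism `E(t) → E'(t)` induced by a homomorphism of fields `E → E'`. -/
def ratFuncMap {E E' : Type*} [Field E] [Field E'] (φ : E →+* E') : RatFunc E →+* RatFunc E' :=
  RatFunc.mapRingHom (Polynomial.mapRingHom φ)
    (nonZeroDivisors_le_comap_nonZeroDivisors_of_injective _ (Polynomial.map_injective φ φ.injective))

/-- The inclusion `\overline{k}(t) ⊆ 𝕃`. -/
def ratFuncToLL (Fq : Type*) [Field Fq] [Fintype Fq] : RatFunc (KBar Fq) →+* LL Fq :=
  RatFunc.liftRingHom ((algebraMap (TateAlg Fq) (LL Fq)).comp TateAlg.ofPoly)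
    (nonZeroDivisors_le_comap_nonZeroDivisors_of_injective _
      ((IsFractionRing.injective (TateAlg Fq) (LL Fq)).comp TateAlg.ofPoly_injective))

/-- The inclusion `F_q ⊆ \overline{k}`. -/
def constToKBar (Fq : Type*) [Field Fq] : Fq →+* KBar Fq :=
  (algebraMap (RatFunc Fq) (KBar Fq)).comp RatFunc.C

namespace DrinfeldModule

variable {Fq : Type*} [Field Fq] [Fintype Fq] (ρ : DrinfeldModule Fq)

/-- The Anderson generating function `f_ω = ∑ exp_ρ(ω / θ ^ (m + 1)) t ^ m` in `𝕋`. -/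
def andersonGen (ω : CInfty Fq) : TateAlg Fq :=
  ⟨PowerSeries.mk (ρ.xi ω), by simpa [TateAlg.mem_iff] using ρ.tendsto_xi ω⟩

/-- For an `A`-basis `ω_i` of `Λ_ρ` the matrix `Υ^(1)`, where `Υ_ij = f_i^(j)` for `0 ≤ j < r`. -/
def upsilonTwist (ω : Module.Basis (Fin ρ.rank) (Polynomial Fq) ρ.periodLattice) :
    Matrix (Fin ρ.rank) (Fin ρ.rank) (TateAlg Fq) :=
  Matrix.of fun i j => TateAlg.twist Fq 1 (TateAlg.twist Fq j (ρ.andersonGen (ω i)))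

theorem xi_sum (s : Finset (Fin ρ.rank)) (c : Fin ρ.rank → Fq) (ω : Fin ρ.rank → CInfty Fq)
    (m : ℕ) : ∑ i ∈ s, algebraMap Fq (CInfty Fq) (c i) * ρ.xi (ω i) m =
      ρ.xi (∑ i ∈ s, algebraMap Fq (CInfty Fq) (c i) * ω i) m := by
  simp only [xi, Finset.sum_div, exp_sum]
  exact Finset.sum_congr rfl fun i _ => by rw [← exp_const_mul, mul_div_assoc]

/-- The `t`-torsion points `exp_ρ(ω_i / θ)` are linearly independent over `F_q`. -/
theorem xi_zero_indep (ω : Module.Basis (Fin ρ.rank) (Polynomial Fq) ρ.periodLattice)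
    (c : Fin ρ.rank → Fq)
    (h : ∑ i, algebraMap Fq (CInfty Fq) (c i) * ρ.xi (ω i) 0 = 0) (i : Fin ρ.rank) : c i = 0 := by
  rw [xi_sum, xi, zero_add, pow_one] at h
  set y : ρ.periodLattice := ⟨_, h⟩ with hy
  have h1 : (∑ i, (Polynomial.C (c i)) • ω i : ρ.periodLattice) =
      (Polynomial.X : Polynomial Fq) • y := by
    apply Subtype.ext
    rw [hy, Submodule.coe_smul, Algebra.smul_def, algebraMap_X, mul_div_cancel₀ _ theta_ne_zero,
      Submodule.coe_sum]
    refine Finset.sum_congr rfl fun i _ => ?_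
    rw [Submodule.coe_smul, Algebra.smul_def, algebraMap_C]
  have h2 := congrArg (fun z => ω.repr z i) h1
  simp only [map_smul, Finsupp.smul_apply, smul_eq_mul] at h2
  rw [ω.repr_sum_self] at h2
  have h3 := congrArg (fun p => Polynomial.coeff p 0) h2
  simpa using h3

/-- A Moore determinant of `F_q`-linearly independent elements does not vanish. -/
theorem moore_det_ne_zero {n : ℕ} (x : Fin n → CInfty Fq)
    (hx : ∀ c : Fin n → Fq, ∑ i, algebraMap Fq (CInfty Fq) (c i) * x i = 0 → ∀ i, c i = 0) :
    (Matrix.of fun i j : Fin n => x i ^ (Fintype.card Fq) ^ (j : ℕ)).det ≠ 0 := by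
  classical
  intro hdet
  obtain ⟨d, hd0, hd⟩ := Matrix.exists_mulVec_eq_zero_iff.mpr hdet
  set P : Polynomial (CInfty Fq) :=
    ∑ j : Fin n, Polynomial.C (d j) * Polynomial.X ^ (Fintype.card Fq) ^ (j : ℕ) with hP
  have hq : 1 < Fintype.card Fq := Fintype.one_lt_card
  have hcoeff : ∀ j : Fin n, P.coeff ((Fintype.card Fq) ^ (j : ℕ)) = d j := by
    intro j
    rw [hP, Polynomial.finsetSum_coeff, Finset.sum_eq_single j]
    · simp
    · intro i _ hij
      rw [Polynomial.coeff_C_mul, Polynomial.coeff_X_pow, if_neg, mul_zero]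
      intro h
      exact hij (Fin.ext (Nat.pow_right_injective hq h.symm))
    · simp
  have hP0 : P ≠ 0 := by
    intro h
    apply hd0
    funext j
    rw [← hcoeff j, h]; simp
  let S : (Fin n → Fq) → CInfty Fq := fun c => ∑ i, algebraMap Fq (CInfty Fq) (c i) * x i
  have hS : Function.Injective S := by
    intro a b hab
    have := hx (fun i => a i - b i) (by
      simp only [map_sub, sub_mul, Finset.sum_sub_distrib]
      exact sub_eq_zero.mpr hab)
    funext i
    exact sub_eq_zero.mp (this i)
  have hroot : ∀ c, P.eval (S c) = 0 := by
    intro c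
    simp only [hP, Polynomial.eval_finsetSum, Polynomial.eval_mul, Polynomial.eval_C,
      Polynomial.eval_pow, Polynomial.eval_X, S, CInfty.sum_pow_card_pow, mul_pow,
      CInfty.algebraMap_pow_card_pow, Finset.mul_sum]
    rw [Finset.sum_comm]
    refine Finset.sum_eq_zero fun i _ => ?_
    have := congrFun hd i
    simp only [Matrix.mulVec, dotProduct, Matrix.of_apply, Pi.zero_apply] at this
    rw [← mul_zero (algebraMap Fq (CInfty Fq) (c i)), ← this, Finset.mul_sum]
    exact Finset.sum_congr rfl fun j _ => by ring
  have hcard : (Fintype.card Fq) ^ n ≤ P.natDegree := by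
    have h1 : Finset.univ.image S ⊆ P.roots.toFinset := by
      intro y hy
      obtain ⟨c, _, rfl⟩ := Finset.mem_image.mp hy
      rw [Multiset.mem_toFinset, Polynomial.mem_roots hP0]
      exact hroot c
    have h2 := Finset.card_le_card h1
    rw [Finset.card_image_of_injective _ hS, Finset.card_univ, Fintype.card_pi_const] at h2
    exact h2.trans ((Multiset.toFinset_card_le _).trans (Polynomial.card_roots' _))
  obtain ⟨j, _⟩ : ∃ j : Fin n, d j ≠ 0 := Function.ne_iff.mp hd0
  have hn : 0 < n := j.pos
  have hdeg : P.natDegree ≤ (Fintype.card Fq) ^ (n - 1) := by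
    refine Polynomial.natDegree_sum_le_of_forall_le _ _ fun j _ => ?_
    refine (Polynomial.natDegree_C_mul_X_pow_le _ _).trans ?_
    exact Nat.pow_le_pow_right (by omega) (by omega)
  have := Nat.pow_lt_pow_right hq (show n - 1 < n by omega)
  omega

theorem upsilonTwist_det_ne_zero
    (ω : Module.Basis (Fin ρ.rank) (Polynomial Fq) ρ.periodLattice) :
    (ρ.upsilonTwist ω).det ≠ 0 := by
  intro h
  have hm := moore_det_ne_zero (fun i => ρ.xi (ω i) 0) (ρ.xi_zero_indep ω)
  have h1 := congrArg (fun f : TateAlg Fq =>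
    PowerSeries.constantCoeff (f : PowerSeries (CInfty Fq))) h
  have h2 := RingHom.map_det (PowerSeries.constantCoeff.comp (TateAlg Fq).subtype)
    (ρ.upsilonTwist ω)
  have h3 := RingHom.map_det (CInfty.frob Fq)
    (Matrix.of fun i j : Fin ρ.rank => ρ.xi (ω i) 0 ^ (Fintype.card Fq) ^ (j : ℕ))
  have h4 : (PowerSeries.constantCoeff.comp (TateAlg Fq).subtype).mapMatrix (ρ.upsilonTwist ω) =
      (CInfty.frob Fq).mapMatrix
        (Matrix.of fun i j : Fin ρ.rank => ρ.xi (ω i) 0 ^ (Fintype.card Fq) ^ (j : ℕ)) := by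
    ext i j
    simp only [RingHom.mapMatrix_apply, Matrix.map_apply, Matrix.of_apply, upsilonTwist,
      RingHom.comp_apply, Subring.coe_subtype, TateAlg.constantCoeff_twist, pow_one,
      CInfty.frob_apply]
    congr 2
  rw [h4, ← h3] at h2
  exact hm ((map_eq_zero (CInfty.frob Fq)).mp (h2.symm.trans h1))

/-- The matrix `V`, with entries `V_ij = κ_{i+j+1}^(-j)` (`0 ≤ i, j < r`), where the `n`-fold twist
of a constant for `n = -j` is its `q ^ j`-th root. As `κ_n = 0` for `n > r`, the entries below the
antidiagonal vanish. -/
def matV : Matrix (Fin ρ.rank) (Fin ρ.rank) (CInfty Fq) :=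
  Matrix.of fun i j => ((CInfty.frobEquiv Fq).symm ^ (j : ℕ)) (ρ.kappa (i + j + 1))

theorem matV_det_ne_zero : ρ.matV.det ≠ 0 := by
  have h1 : (ρ.matV.submatrix id Fin.revPerm).det ≠ 0 := by
    rw [Matrix.det_of_isUpperTriangular]
    · refine Finset.prod_ne_zero_iff.mpr fun i _ => ?_
      simp only [Matrix.submatrix_apply, matV, Matrix.of_apply, id, Fin.revPerm_apply,
        Fin.val_rev]
      rw [show (i : ℕ) + (ρ.rank - (i + 1)) + 1 = ρ.rank by omega]
      exact (map_ne_zero_iff _ (RingEquiv.injective _)).mpr ρ.kappa_rank_ne_zero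
    · intro i j hij
      simp only [id] at hij
      simp only [Matrix.submatrix_apply, matV, Matrix.of_apply, id, Fin.revPerm_apply,
        Fin.val_rev]
      rw [ρ.kappa_eq_zero (by have : (j : ℕ) < i := hij; omega), map_zero]
  intro h
  apply h1
  rw [Matrix.det_permute', h, mul_zero]

/-- The rigid analytic trivialization `Ψ_ρ = V⁻¹ [Υ^(1)]⁻¹ ∈ GL_r(𝕃)`. -/
def psi (ω : Module.Basis (Fin ρ.rank) (Polynomial Fq) ρ.periodLattice) : GL (Fin ρ.rank) (LL Fq) :=
  (Matrix.GeneralLinearGroup.mkOfDetNeZero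
    (((algebraMap (TateAlg Fq) (LL Fq)).comp (TateAlg.const Fq)).mapMatrix ρ.matV) (by
      rw [← RingHom.map_det]
      exact (map_ne_zero _).mpr ρ.matV_det_ne_zero))⁻¹ *
  (Matrix.GeneralLinearGroup.mkOfDetNeZero
    ((algebraMap (TateAlg Fq) (LL Fq)).mapMatrix (ρ.upsilonTwist ω)) (by
      rw [← RingHom.map_det]
      exact (map_ne_zero_iff _ (IsFractionRing.injective (TateAlg Fq) (LL Fq))).mpr
        (ρ.upsilonTwist_det_ne_zero ω)))⁻¹

end DrinfeldModule

/-- The coordinate ring `R[X, 1 / det X]` of `GL_n` over `R`. -/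
abbrev GLCoord (R : Type*) [CommRing R] (n : ℕ) : Type _ :=
  Localization.Away (Matrix.mvPolynomialX (Fin n) (Fin n) R).det

/-- The inclusion `F(t) ⊆ F((t))`. -/
def ratFuncToLaurent (F : Type*) [Field F] : RatFunc F →+* LaurentSeries F :=
  RatFunc.liftRingHom ((HahnSeries.ofPowerSeries ℤ F).comp Polynomial.coeToPowerSeries.ringHom)
    (nonZeroDivisors_le_comap_nonZeroDivisors_of_injective _
      (HahnSeries.ofPowerSeries_injective.comp (Polynomial.coe_injective F)))

namespace GLCoord

variable {R S : Type*} [CommRing R] [CommRing S] {n : ℕ}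

/-- Evaluation of elements of `R[X, 1 / det X]` at `g ∈ GL_n(S)`, for an `R`-algebra `S`. -/
def eval (φ : R →+* S) (g : GL (Fin n) S) : GLCoord R n →+* S :=
  IsLocalization.Away.lift (Matrix.mvPolynomialX (Fin n) (Fin n) R).det
    (g := MvPolynomial.eval₂Hom φ fun p : Fin n × Fin n => g p.1 p.2) (by
      rw [RingHom.map_det]
      have : (MvPolynomial.eval₂Hom φ fun p : Fin n × Fin n => g p.1 p.2).mapMatrix
          (Matrix.mvPolynomialX (Fin n) (Fin n) R) = g := by
        ext i j; simp
      rw [this]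
      exact (Matrix.isUnit_iff_isUnit_det _).mp g.isUnit)

/-- The base change `R[X, 1 / det X] → S[X, 1 / det X]`. -/
def baseChange (φ : R →+* S) : GLCoord R n →+* GLCoord S n :=
  IsLocalization.Away.lift (Matrix.mvPolynomialX (Fin n) (Fin n) R).det
    (g := (algebraMap (MvPolynomial (Fin n × Fin n) S) (GLCoord S n)).comp
      (MvPolynomial.map φ)) (by
      have : (MvPolynomial.map φ).mapMatrix (Matrix.mvPolynomialX (Fin n) (Fin n) R) =
          Matrix.mvPolynomialX (Fin n) (Fin n) S := by
        ext i j; simp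
      rw [RingHom.comp_apply, RingHom.map_det, this]
      exact IsLocalization.Away.algebraMap_isUnit _)

/-- The `S`-valued points of the closed subscheme of `GL_n / R` with ideal `I`. -/
def points (φ : R →+* S) (I : Ideal (GLCoord R n)) : Set (GL (Fin n) S) :=
  {g | ∀ h ∈ I, eval φ g h = 0}

/-- The closed subscheme of `GL_n / S` with ideal `I` is defined over `R`, i.e. it is the base
change of a closed subscheme of `GL_n / R`. -/
def IsDefinedOver (φ : R →+* S) (I : Ideal (GLCoord S n)) : Prop :=
  ∃ J : Ideal (GLCoord R n), I = J.map (baseChange φ)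

end GLCoord

section DifferenceGalois

variable {F K L : Type*} [Field F] [Field K] [Field L] {n : ℕ}

/-- The ideal of `Z_Ψ`, the smallest closed subscheme of `GL_n / K` having `Ψ` as an `L`-valued
point: the kernel of `X_ij ↦ Ψ_ij`. -/
def idealZ (φ : K →+* L) (Ψ : GL (Fin n) L) : Ideal (GLCoord K n) :=
  RingHom.ker (GLCoord.eval φ Ψ)

/-- The ideal of `Γ_Ψ`, the smallest closed subscheme of `GL_n / F` such that
`Γ_Ψ(\overline L) ⊇ Ψ⁻¹ Z_Ψ(\overline L)`. -/
def idealGamma (ψ : F →+* K) (φ : K →+* L) (Ψ : GL (Fin n) L) : Ideal (GLCoord F n) :=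
  ⨅ z ∈ GLCoord.points ((algebraMap L (AlgebraicClosure L)).comp φ) (idealZ φ Ψ),
    RingHom.ker (GLCoord.eval (((algebraMap L (AlgebraicClosure L)).comp φ).comp ψ)
      ((Matrix.GeneralLinearGroup.map (algebraMap L (AlgebraicClosure L)) Ψ)⁻¹ * z))

end DifferenceGalois

namespace DrinfeldModule

variable {Fq : Type*} [Field Fq] [Fintype Fq] (ρ : DrinfeldModule Fq)

/-- The ideal of `Z_{Ψ_ρ} ⊆ GL_r / \overline{k}(t)`. -/
def idealZPsi (ω : Module.Basis (Fin ρ.rank) (Polynomial Fq) ρ.periodLattice) :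
    Ideal (GLCoord (RatFunc (KBar Fq)) ρ.rank) :=
  idealZ (ratFuncToLL Fq) (ρ.psi ω)

/-- The ideal of `Γ_{Ψ_ρ} ⊆ GL_r / F_q(t)`, for the triple of fields
`F_q(t) ⊆ \overline{k}(t) ⊆ 𝕃`. -/
def idealGammaPsi (ω : Module.Basis (Fin ρ.rank) (Polynomial Fq) ρ.periodLattice) :
    Ideal (GLCoord (RatFunc Fq) ρ.rank) :=
  idealGamma (ratFuncMap (constToKBar Fq)) (ratFuncToLL Fq) (ρ.psi ω)

/-- The endomorphism ring `End(ρ)`: the `b ∈ ℂ_∞[τ]` such that `b ρ_a = ρ_a b` for all `a`. -/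
def endRing : Subring (TwistedPoly Fq) := Subring.centralizer (Set.range ρ.toRingHom)

end DrinfeldModule

/-- The twisted polynomials with coefficients in a subfield `K` of `\overline k`. -/
def TwistedPoly.over {Fq : Type*} [Field Fq] [Fintype Fq]
    (K : IntermediateField (RatFunc Fq) (KBar Fq)) : Set (TwistedPoly Fq) :=
  {b | ∀ n, ∃ c : K, SkewPolynomial.coeff b n = algebraMap (KBar Fq) (CInfty Fq) c}

namespace DrinfeldModule

variable {Fq : Type*} [Field Fq] [Fintype Fq] (ρ : DrinfeldModule Fq)

/-- `ρ` is defined over `K`: `ρ(F_q[t]) ⊆ K[τ]`. -/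
def IsDefinedOver (K : IntermediateField (RatFunc Fq) (KBar Fq)) : Prop :=
  ∀ a, ρ.toRingHom a ∈ TwistedPoly.over K

/-- The torsion `ρ[a]`. -/
def torsion (a : Polynomial Fq) : Set (CInfty Fq) := {x | (ρ.toRingHom a).eval x = 0}

theorem torsion_of_compat {y : ℕ → CInfty Fq} (h0 : ρ.rhoT.eval (y 0) = 0)
    (h : ∀ m, ρ.rhoT.eval (y (m + 1)) = y m) (m : ℕ) :
    y m ∈ ρ.torsion (Polynomial.X ^ (m + 1)) := by
  induction m with
  | zero => rw [zero_add, pow_one]; exact h0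
  | succ m ih =>
    change (ρ.toRingHom _).eval _ = 0
    rw [pow_succ, map_mul, TwistedPoly.eval_mul]
    change (ρ.toRingHom _).eval (ρ.rhoT.eval _) = 0
    rw [h]
    exact ih

theorem coeff_smul (a : PowerSeries Fq) (f : PowerSeries (CInfty Fq)) (m : ℕ) :
    PowerSeries.coeff m (a • f) = ∑ p ∈ Finset.HasAntidiagonal.antidiagonal m,
      algebraMap Fq (CInfty Fq) (PowerSeries.coeff p.1 a) * PowerSeries.coeff p.2 f := by
  rw [Algebra.smul_def, PowerSeries.coeff_mul]
  rfl

/-- The `t`-adic Tate module `T_t(ρ) = lim ρ[t ^ m]`. A compatible system `(y_0, y_1, …)`, where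
`y_m ∈ ρ[t ^ (m + 1)]` and `ρ_t(y_{m+1}) = y_m`, is stored as the power series `∑ y_m t ^ m`;
the action of `F_q[[t]]` on the inverse limit is then the multiplication of power series, see
`coeff_smul_tateModule`. -/
def tateModule : Submodule (PowerSeries Fq) (PowerSeries (CInfty Fq)) where
  carrier := {f | (∀ m, PowerSeries.coeff m f ∈ ρ.torsion (Polynomial.X ^ (m + 1))) ∧
    ∀ m, ρ.rhoT.eval (PowerSeries.coeff (m + 1) f) = PowerSeries.coeff m f}
  add_mem' {f g} hf hg := by
    refine ⟨fun m => ?_, fun m => ?_⟩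
    · change (ρ.toRingHom _).eval _ = 0
      rw [map_add, TwistedPoly.eval_apply_add]
      rw [show (ρ.toRingHom _).eval _ = 0 from hf.1 m, show (ρ.toRingHom _).eval _ = 0 from hg.1 m,
        add_zero]
    · rw [map_add, TwistedPoly.eval_apply_add, hf.2, hg.2, map_add]
  zero_mem' := by
    refine ⟨fun m => ?_, fun m => ?_⟩
    · change (ρ.toRingHom _).eval _ = 0
      rw [map_zero, TwistedPoly.eval_apply_zero]
    · rw [map_zero, map_zero, TwistedPoly.eval_apply_zero]
  smul_mem' a f hf := by
    have h0 : ρ.rhoT.eval (PowerSeries.coeff 0 f) = 0 := by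
      have := hf.1 0
      rwa [zero_add, pow_one] at this
    have h1 : ρ.rhoT.eval (PowerSeries.coeff 0 (a • f)) = 0 := by
      rw [coeff_smul, TwistedPoly.eval_apply_sum]
      simp only [Finset.HasAntidiagonal.antidiagonal_zero, Finset.sum_singleton,
        TwistedPoly.eval_apply_const_mul, h0, mul_zero]
    have h2 : ∀ m, ρ.rhoT.eval (PowerSeries.coeff (m + 1) (a • f)) =
        PowerSeries.coeff m (a • f) := by
      intro m
      rw [coeff_smul, coeff_smul, TwistedPoly.eval_apply_sum, Finset.Nat.sum_antidiagonal_succ']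
      simp only [TwistedPoly.eval_apply_const_mul, h0, hf.2, mul_zero, zero_add]
    exact ⟨ρ.torsion_of_compat h1 h2, h2⟩

theorem mem_tateModule {f : PowerSeries (CInfty Fq)} : f ∈ ρ.tateModule ↔
    ρ.rhoT.eval (PowerSeries.coeff 0 f) = 0 ∧
      ∀ m, ρ.rhoT.eval (PowerSeries.coeff (m + 1) f) = PowerSeries.coeff m f := by
  refine ⟨fun h => ⟨?_, h.2⟩, fun h => ⟨ρ.torsion_of_compat h.1 h.2, h.2⟩⟩
  have := h.1 0
  rwa [zero_add, pow_one] at this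

theorem eval_X_pow {f : PowerSeries (CInfty Fq)} (hf : f ∈ ρ.tateModule) (l m : ℕ) :
    (ρ.toRingHom (Polynomial.X ^ l)).eval (PowerSeries.coeff m f) =
      if l ≤ m then PowerSeries.coeff (m - l) f else 0 := by
  obtain ⟨h0, h1⟩ := ρ.mem_tateModule.mp hf
  induction l generalizing m with
  | zero =>
    rw [pow_zero, map_one, ← SkewPolynomial.C_1, TwistedPoly.eval_C]; simp
  | succ l ih =>
    rw [pow_succ, map_mul, TwistedPoly.eval_mul]
    change (ρ.toRingHom _).eval (ρ.rhoT.eval _) = _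
    cases m with
    | zero => rw [h0, TwistedPoly.eval_apply_zero]; simp
    | succ m =>
      rw [h1, ih]
      simp

/-- The action of `a ∈ F_q[[t]]` on `T_t(ρ)` is the usual one: on the component `y_m`, which lies
in `ρ[t ^ (m + 1)]`, it is the action of `a mod t ^ (m + 1)` through `ρ`. -/
theorem coeff_smul_tateModule (a : PowerSeries Fq) {f : PowerSeries (CInfty Fq)}
    (hf : f ∈ ρ.tateModule) (m : ℕ) :
    PowerSeries.coeff m (a • f) =
      (ρ.toRingHom (PowerSeries.trunc (m + 1) a)).eval (PowerSeries.coeff m f) := by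
  have hlin : ∀ (N : ℕ) (c : ℕ → Fq) (x : CInfty Fq),
      (ρ.toRingHom (∑ l ∈ Finset.range N, Polynomial.monomial l (c l))).eval x =
        ∑ l ∈ Finset.range N,
          algebraMap Fq (CInfty Fq) (c l) * (ρ.toRingHom (Polynomial.X ^ l)).eval x := by
    intro N c x
    induction N with
    | zero => simp [TwistedPoly.eval_zero_left]
    | succ N ih =>
      rw [Finset.sum_range_succ, map_add, TwistedPoly.eval_add, ih, Finset.sum_range_succ,
        ← Polynomial.C_mul_X_pow_eq_monomial, map_mul, TwistedPoly.eval_mul, ρ.map_C,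
        TwistedPoly.eval_C]
  rw [PowerSeries.trunc_apply, ← Finset.range_eq_Ico, hlin, coeff_smul,
    Finset.Nat.sum_antidiagonal_eq_sum_range_succ_mk]
  refine Finset.sum_congr rfl fun l hl => ?_
  rw [Finset.mem_range] at hl
  rw [ρ.eval_X_pow hf, if_pos (by omega)]

end DrinfeldModule

/-- The separable closure `K^sep` of `K` inside `\overline k`. -/
abbrev KSep {Fq : Type*} [Field Fq] (K : IntermediateField (RatFunc Fq) (KBar Fq)) :
    IntermediateField K (KBar Fq) :=
  separableClosure K (KBar Fq)

/-- The inclusion `K^sep ⊆ ℂ_∞`. -/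
def sepToC {Fq : Type*} [Field Fq] [Fintype Fq] (K : IntermediateField (RatFunc Fq) (KBar Fq)) :
    KSep K →+* CInfty Fq :=
  (algebraMap (KBar Fq) (CInfty Fq)).comp (algebraMap (KSep K) (KBar Fq))

namespace DrinfeldModule

variable {Fq : Type*} [Field Fq] [Fintype Fq] (ρ : DrinfeldModule Fq)
  (K : IntermediateField (RatFunc Fq) (KBar Fq))

theorem torsion_subset_sep (hρ : ρ.IsDefinedOver K) {a : Polynomial Fq} (ha : a ≠ 0)
    {x : CInfty Fq} (hx : x ∈ ρ.torsion a) : ∃ y : KSep K, sepToC K y = x := by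
  obtain ⟨N, hN⟩ := TwistedPoly.exists_bound (ρ.toRingHom a)
  choose c hc using hρ a
  have hcq : ((Fintype.card Fq : ℕ) : K) = 0 := by
    rw [← map_natCast ((algebraMap (RatFunc Fq) K).comp RatFunc.C), FiniteField.cast_card_eq_zero,
      map_zero]
  have hc0 : c 0 ≠ 0 := by
    intro h
    have h1 := hc 0
    rw [h, ρ.coeff_zero] at h1
    have h2 : algebraMap (RatFunc Fq) (CInfty Fq) (algebraMap (Polynomial Fq) (RatFunc Fq) a) = 0 :=
      h1.trans (map_zero (algebraMap (KBar Fq) (CInfty Fq)))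
    rw [map_eq_zero] at h2
    exact ha (by simpa using h2)
  set P : Polynomial K := ∑ n ∈ Finset.range (N + 1),
    Polynomial.C (c n) * Polynomial.X ^ (Fintype.card Fq) ^ n with hP
  have hder : P.derivative = Polynomial.C (c 0) := by
    rw [hP, Polynomial.derivative_sum, Finset.sum_range_succ']
    rw [Finset.sum_eq_zero]
    · simp
    · intro n _
      rw [Polynomial.derivative_C_mul_X_pow]
      simp [hcq]
  have hsep : P.Separable := by
    rw [Polynomial.Separable, hder]
    exact (isCoprime_one_right.of_isCoprime_of_dvd_right
      (Polynomial.isUnit_C.mpr (IsUnit.mk0 _ hc0)).dvd)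
  have hP0 : P ≠ 0 := hsep.ne_zero
  set ι : K →+* CInfty Fq := (algebraMap (KBar Fq) (CInfty Fq)).comp (algebraMap K (KBar Fq))
    with hι
  have hroot : P.eval₂ ι x = 0 := by
    have h1 : (ρ.toRingHom a).eval x = 0 := hx
    rw [TwistedPoly.eval_eq_sum_range _ (N + 1) (fun n h => hN n (by omega))] at h1
    rw [hP, Polynomial.eval₂_finsetSum]
    rw [← h1]
    refine Finset.sum_congr rfl fun n _ => ?_
    rw [hc]
    simp [hι]
  have : IsAlgClosed (KBar Fq) := (algebraicClosure.isAlgClosure (F := RatFunc Fq)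
    (E := KInftyBar Fq)).isAlgClosed
  have hspl : (P.map (algebraMap K (KBar Fq))).Splits := IsAlgClosed.splits _
  obtain ⟨y, hy, hyx⟩ : ∃ y : KBar Fq, P.eval₂ (algebraMap K (KBar Fq)) y = 0 ∧
      algebraMap (KBar Fq) (CInfty Fq) y = x := by
    have h2 : ((P.map (algebraMap K (KBar Fq))).map (algebraMap (KBar Fq) (CInfty Fq))).IsRoot x := by
      rw [Polynomial.map_map, Polynomial.IsRoot, Polynomial.eval_map]
      exact hroot
    have h3 := (Polynomial.mem_roots (by
      simpa [Polynomial.map_eq_zero] using hP0)).mpr h2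
    rw [hspl.roots_map] at h3
    obtain ⟨y, hy, hyx⟩ := Multiset.mem_map.mp h3
    exact ⟨y, by simpa [Polynomial.eval_map] using Polynomial.isRoot_of_mem_roots hy, hyx⟩
  have hys : IsSeparable K y := hsep.of_dvd (minpoly.dvd K y hy)
  exact ⟨⟨y, mem_separableClosure_iff.mpr hys⟩, hyx⟩

end DrinfeldModule

namespace DrinfeldModule

variable {Fq : Type*} [Field Fq] [Fintype Fq] (ρ : DrinfeldModule Fq)
  (K : IntermediateField (RatFunc Fq) (KBar Fq))

/-- On elements of `K^sep` the map `ρ_a` is given by a map commuting with the Galois group. -/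
theorem exists_eval_sep (hρ : ρ.IsDefinedOver K) (a : Polynomial Fq) : ∃ G : KSep K → KSep K,
    (∀ y, (ρ.toRingHom a).eval (sepToC K y) = sepToC K (G y)) ∧
    ∀ (ε : KSep K ≃ₐ[K] KSep K) (y), ε (G y) = G (ε y) := by
  obtain ⟨N, hN⟩ := TwistedPoly.exists_bound (ρ.toRingHom a)
  choose c hc using hρ a
  refine ⟨fun y => ∑ n ∈ Finset.range N, algebraMap K (KSep K) (c n) * y ^ (Fintype.card Fq) ^ n,
    fun y => ?_, fun ε y => ?_⟩
  · rw [TwistedPoly.eval_eq_sum_range _ N hN, map_sum]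
    refine Finset.sum_congr rfl fun n _ => ?_
    rw [hc, map_mul, map_pow]
    rfl
  · simp only [map_sum, map_mul, map_pow, AlgEquiv.commutes]

theorem exists_sep_series (hρ : ρ.IsDefinedOver K) {f : PowerSeries (CInfty Fq)}
    (hf : f ∈ ρ.tateModule) : ∃ g : PowerSeries (KSep K), PowerSeries.map (sepToC K) g = f := by
  have h : ∀ m, ∃ y : KSep K, sepToC K y = PowerSeries.coeff m f := fun m =>
    ρ.torsion_subset_sep K hρ (pow_ne_zero _ Polynomial.X_ne_zero) (hf.1 m)
  choose y hy using h
  exact ⟨PowerSeries.mk y, by ext m; simp [hy]⟩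

theorem map_sepToC_injective : Function.Injective (PowerSeries.map (sepToC K)) := by
  intro f g h
  ext m
  have := congrArg (PowerSeries.coeff m) h
  rw [PowerSeries.coeff_map, PowerSeries.coeff_map] at this
  rw [(sepToC K).injective this]

/-- The lift of an element of `T_t(ρ)` to a power series with coefficients in `K^sep`. -/
def sepSeries (hρ : ρ.IsDefinedOver K) (f : ρ.tateModule) : PowerSeries (KSep K) :=
  (ρ.exists_sep_series K hρ f.2).choose

theorem map_sepSeries (hρ : ρ.IsDefinedOver K) (f : ρ.tateModule) :
    PowerSeries.map (sepToC K) (ρ.sepSeries K hρ f) = f :=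
  (ρ.exists_sep_series K hρ f.2).choose_spec

theorem sepSeries_eq (hρ : ρ.IsDefinedOver K) (f : ρ.tateModule) {g : PowerSeries (KSep K)}
    (h : PowerSeries.map (sepToC K) g = f) : ρ.sepSeries K hρ f = g :=
  map_sepToC_injective K ((ρ.map_sepSeries K hρ f).trans h.symm)

theorem coeff_sepSeries (hρ : ρ.IsDefinedOver K) (f : ρ.tateModule) (m : ℕ) :
    sepToC K (PowerSeries.coeff m (ρ.sepSeries K hρ f)) =
      PowerSeries.coeff m (f : PowerSeries (CInfty Fq)) := by
  conv_rhs => rw [← ρ.map_sepSeries K hρ f]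
  rw [PowerSeries.coeff_map]

theorem map_mem_tateModule {E : Type*} [Field E] (j : E →+* CInfty Fq) (σ : E →+* E) (G : E → E)
    (hG : ∀ y, ρ.rhoT.eval (j y) = j (G y)) (hσ : ∀ y, σ (G y) = G (σ y)) (g : PowerSeries E)
    (hg : PowerSeries.map j g ∈ ρ.tateModule) :
    PowerSeries.map j (PowerSeries.map σ g) ∈ ρ.tateModule := by
  obtain ⟨h0, h1⟩ := ρ.mem_tateModule.mp hg
  refine ρ.mem_tateModule.mpr ⟨?_, fun m => ?_⟩
  · rw [PowerSeries.coeff_map, PowerSeries.coeff_map, hG, ← hσ]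
    rw [PowerSeries.coeff_map, hG, map_eq_zero] at h0
    rw [h0, map_zero, map_zero]
  · have h2 := h1 m
    rw [PowerSeries.coeff_map, PowerSeries.coeff_map, hG] at h2
    simp only [PowerSeries.coeff_map]
    rw [hG, ← hσ, j.injective h2]

theorem map_smul_series {E : Type*} [Field E] (j : E →+* CInfty Fq) (σ : E →+* E) (ι : Fq →+* E)
    (hj : ∀ c, j (ι c) = algebraMap Fq (CInfty Fq) c) (hσ : ∀ c, σ (ι c) = ι c)
    (a : PowerSeries Fq) (g : PowerSeries E) :
    PowerSeries.map j (PowerSeries.map ι a * g) = a • PowerSeries.map j g ∧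
    PowerSeries.map j (PowerSeries.map σ (PowerSeries.map ι a * g)) =
      a • PowerSeries.map j (PowerSeries.map σ g) := by
  have h3 : PowerSeries.map j (PowerSeries.map ι a) =
      algebraMap (PowerSeries Fq) (PowerSeries (CInfty Fq)) a := by
    ext m; simp only [PowerSeries.coeff_map, hj]; rfl
  have h4 : PowerSeries.map σ (PowerSeries.map ι a) = PowerSeries.map ι a := by
    ext m
    simp only [PowerSeries.coeff_map, hσ]
  rw [map_mul, map_mul, map_mul, h4, h3, Algebra.smul_def, Algebra.smul_def]
  exact ⟨rfl, rfl⟩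

/-- An element `ε ∈ Gal(K^sep / K)` as a ring homomorphism. -/
def galHom (ε : KSep K ≃ₐ[K] KSep K) : KSep K →+* KSep K := ε.toRingEquiv.toRingHom

theorem galHom_apply (ε : KSep K ≃ₐ[K] KSep K) (y : KSep K) : galHom K ε y = ε y := rfl

theorem galois_mem (hρ : ρ.IsDefinedOver K) (ε : KSep K ≃ₐ[K] KSep K) (f : ρ.tateModule) :
    PowerSeries.map (sepToC K) (PowerSeries.map (galHom K ε) (ρ.sepSeries K hρ f)) ∈
      ρ.tateModule := by
  obtain ⟨G, hG, hε⟩ := ρ.exists_eval_sep K hρ Polynomial.X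
  exact ρ.map_mem_tateModule (sepToC K) (galHom K ε) G hG (hε ε) _
    ((ρ.map_sepSeries K hρ f).symm ▸ f.2)

/-- The action of `ε ∈ Gal(K^sep / K)` on `T_t(ρ)`, component by component. -/
def galoisFun (hρ : ρ.IsDefinedOver K) (ε : KSep K ≃ₐ[K] KSep K) (f : ρ.tateModule) :
    ρ.tateModule :=
  ⟨PowerSeries.map (sepToC K) (PowerSeries.map (galHom K ε) (ρ.sepSeries K hρ f)),
    ρ.galois_mem K hρ ε f⟩

theorem coe_galoisFun (hρ : ρ.IsDefinedOver K) (ε : KSep K ≃ₐ[K] KSep K) (f : ρ.tateModule) :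
    (ρ.galoisFun K hρ ε f : PowerSeries (CInfty Fq)) =
      PowerSeries.map (sepToC K) (PowerSeries.map (galHom K ε) (ρ.sepSeries K hρ f)) := rfl

theorem sepSeries_add (hρ : ρ.IsDefinedOver K) (f g : ρ.tateModule) :
    ρ.sepSeries K hρ (f + g) = ρ.sepSeries K hρ f + ρ.sepSeries K hρ g :=
  ρ.sepSeries_eq K hρ (f + g) (by
    rw [map_add, map_sepSeries, map_sepSeries, Submodule.coe_add])

theorem galoisFun_smul (hρ : ρ.IsDefinedOver K) (ε : KSep K ≃ₐ[K] KSep K) (a : PowerSeries Fq)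
    (f : ρ.tateModule) : ρ.galoisFun K hρ ε (a • f) = a • ρ.galoisFun K hρ ε f := by
  apply Subtype.ext
  set ι : Fq →+* KSep K := (algebraMap K (KSep K)).comp
    ((algebraMap (RatFunc Fq) K).comp RatFunc.C) with hι
  obtain ⟨h1, h2⟩ := map_smul_series (sepToC K) (galHom K ε) ι (fun c => rfl)
    (fun c => ε.commutes _) a (ρ.sepSeries K hρ f)
  rw [map_sepSeries] at h1
  rw [coe_galoisFun, Submodule.coe_smul, coe_galoisFun, ← h2]
  rw [ρ.sepSeries_eq K hρ (a • f) (h1.trans (Submodule.coe_smul _ _).symm)]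

/-- `galoisFun` as a linear map. -/
def galoisAct (hρ : ρ.IsDefinedOver K) (ε : KSep K ≃ₐ[K] KSep K) :
    ρ.tateModule →ₗ[PowerSeries Fq] ρ.tateModule where
  toFun := ρ.galoisFun K hρ ε
  map_add' f g := by
    apply Subtype.ext
    rw [Submodule.coe_add, coe_galoisFun, coe_galoisFun, coe_galoisFun, sepSeries_add, map_add,
      map_add]
  map_smul' := ρ.galoisFun_smul K hρ ε

theorem coeff_galoisFun (hρ : ρ.IsDefinedOver K) (ε : KSep K ≃ₐ[K] KSep K) (f : ρ.tateModule)
    (m : ℕ) : PowerSeries.coeff m (ρ.galoisFun K hρ ε f : PowerSeries (CInfty Fq)) =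
      sepToC K (ε (PowerSeries.coeff m (ρ.sepSeries K hρ f))) := by
  rw [coe_galoisFun, PowerSeries.coeff_map, PowerSeries.coeff_map, galHom_apply]

/-- The `t`-adic Galois representation `φ_t : Gal(K^sep / K) → Aut(T_t(ρ))`. -/
def galoisRep (hρ : ρ.IsDefinedOver K) :
    (KSep K ≃ₐ[K] KSep K) →* Module.End (PowerSeries Fq) ρ.tateModule where
  toFun := ρ.galoisAct K hρ
  map_one' := by
    refine LinearMap.ext fun f => Subtype.ext (PowerSeries.ext fun m => ?_)
    change PowerSeries.coeff m (ρ.galoisFun K hρ 1 f : PowerSeries (CInfty Fq)) = _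
    rw [coeff_galoisFun]
    exact ρ.coeff_sepSeries K hρ f m
  map_mul' ε₁ ε₂ := by
    refine LinearMap.ext fun f => Subtype.ext (PowerSeries.ext fun m => ?_)
    change PowerSeries.coeff m (ρ.galoisFun K hρ (ε₁ * ε₂) f : PowerSeries (CInfty Fq)) =
      PowerSeries.coeff m (ρ.galoisFun K hρ ε₁ (ρ.galoisFun K hρ ε₂ f) : PowerSeries (CInfty Fq))
    rw [coeff_galoisFun, coeff_galoisFun, ρ.sepSeries_eq K hρ (ρ.galoisFun K hρ ε₂ f)
      (ρ.coe_galoisFun K hρ ε₂ f).symm, PowerSeries.coeff_map, galHom_apply]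
    rfl

/-- The components of `φ_t(ε)(y)` are the `ε(y_m)`. -/
theorem coeff_galoisRep (hρ : ρ.IsDefinedOver K) (ε : KSep K ≃ₐ[K] KSep K) (f : ρ.tateModule)
    (m : ℕ) (y : KSep K)
    (hy : sepToC K y = PowerSeries.coeff m (f : PowerSeries (CInfty Fq))) :
    PowerSeries.coeff m (ρ.galoisRep K hρ ε f : PowerSeries (CInfty Fq)) = sepToC K (ε y) := by
  rw [← ρ.coeff_sepSeries K hρ] at hy
  rw [(sepToC K).injective hy]
  exact ρ.coeff_galoisFun K hρ ε f m

variable (ω : Module.Basis (Fin ρ.rank) (Polynomial Fq) ρ.periodLattice)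

/-- The element `x_i = (ξ_{i,0}, ξ_{i,1}, …)` of `T_t(ρ)`, where
`ξ_{i,m} = exp_ρ(ω_i / θ ^ (m + 1))`. -/
def tateVec (i : Fin ρ.rank) : ρ.tateModule :=
  ⟨PowerSeries.mk (ρ.xi (ω i)), ρ.mem_tateModule.mpr ⟨by
    rw [PowerSeries.coeff_mk]; exact ρ.rhoT_xi_zero (ω i).2, fun m => by
    rw [PowerSeries.coeff_mk, PowerSeries.coeff_mk]; exact ρ.rhoT_xi_succ _ m⟩⟩

theorem coeff_sum_smul_tateVec (a : Fin ρ.rank → PowerSeries Fq) (m : ℕ) :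
    PowerSeries.coeff m ((∑ i, a i • ρ.tateVec ω i : ρ.tateModule) : PowerSeries (CInfty Fq)) =
      ∑ i, ∑ p ∈ Finset.HasAntidiagonal.antidiagonal m,
        algebraMap Fq (CInfty Fq) (PowerSeries.coeff p.1 (a i)) * ρ.xi (ω i) p.2 := by
  rw [Submodule.coe_sum, map_sum]
  refine Finset.sum_congr rfl fun i _ => ?_
  rw [Submodule.coe_smul, coeff_smul]
  simp [tateVec]

theorem tateVec_linearIndependent : LinearIndependent (PowerSeries Fq) (ρ.tateVec ω) := by
  rw [Fintype.linearIndependent_iff]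
  intro a h
  have key : ∀ n i, PowerSeries.coeff n (a i) = 0 := by
    intro n
    induction n using Nat.strong_induction_on with
    | _ n ih =>
      refine ρ.xi_zero_indep ω _ ?_
      have h1 := ρ.coeff_sum_smul_tateVec ω a n
      rw [h] at h1
      rw [Submodule.coe_zero, map_zero] at h1
      rw [h1]
      refine Finset.sum_congr rfl fun i _ => ?_
      rw [Finset.sum_eq_single (n, 0)]
      · rintro ⟨p, r⟩ hp hne
        rw [Finset.HasAntidiagonal.mem_antidiagonal] at hp
        rw [ih p (by
          rcases Nat.eq_zero_or_pos r with hr | hr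
          · subst hr
            exact absurd (by simpa using hp) hne
          · simp only at hp; omega), map_zero, zero_mul]
      · intro h; simp at h
  intro i
  ext n
  rw [key, map_zero]

/-- `ρ[t]` is spanned over `F_q` by the `exp_ρ(ω_i / θ)`. -/
theorem exists_eq_sum_xi_zero {x : CInfty Fq} (hx : ρ.rhoT.eval x = 0) :
    ∃ c : Fin ρ.rank → Fq, x = ∑ i, algebraMap Fq (CInfty Fq) (c i) * ρ.xi (ω i) 0 := by
  classical
  have hq : 1 < Fintype.card Fq := Fintype.one_lt_card
  set P : Polynomial (CInfty Fq) := ∑ j ∈ Finset.range (ρ.rank + 1),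
    Polynomial.C (ρ.kappa j) * Polynomial.X ^ (Fintype.card Fq) ^ j with hP
  have hPe : ∀ y, P.eval y = ρ.rhoT.eval y := by
    intro y
    rw [hP, eval_rhoT, Polynomial.eval_finsetSum]
    simp
  have hP0 : P ≠ 0 := by
    intro h
    have h1 : P.coeff 1 = ρ.kappa 0 := by
      rw [hP, Polynomial.finsetSum_coeff, Finset.sum_eq_single 0]
      · simp
      · intro j _ hj
        rw [Polynomial.coeff_C_mul, Polynomial.coeff_X_pow, if_neg, mul_zero]
        exact (Nat.one_lt_pow hj hq).ne
      · simp
    rw [h, kappa_zero, Polynomial.coeff_zero] at h1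
    exact theta_ne_zero h1.symm
  have hdeg : P.natDegree ≤ (Fintype.card Fq) ^ ρ.rank := by
    refine Polynomial.natDegree_sum_le_of_forall_le _ _ fun j hj => ?_
    rw [Finset.mem_range] at hj
    exact (Polynomial.natDegree_C_mul_X_pow_le _ _).trans
      (Nat.pow_le_pow_right (by omega) (by omega))
  let S : (Fin ρ.rank → Fq) → CInfty Fq := fun c =>
    ∑ i, algebraMap Fq (CInfty Fq) (c i) * ρ.xi (ω i) 0
  have hS : Function.Injective S := by
    intro a b hab
    have := ρ.xi_zero_indep ω (fun i => a i - b i) (by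
      simp only [map_sub, sub_mul, Finset.sum_sub_distrib]
      exact sub_eq_zero.mpr hab)
    funext i
    exact sub_eq_zero.mp (this i)
  have hsub : Finset.univ.image S ⊆ P.roots.toFinset := by
    intro y hy
    obtain ⟨c, _, rfl⟩ := Finset.mem_image.mp hy
    rw [Multiset.mem_toFinset, Polynomial.mem_roots hP0, Polynomial.IsRoot, hPe]
    simp only [S, TwistedPoly.eval_apply_sum, TwistedPoly.eval_apply_const_mul,
      ρ.rhoT_xi_zero (ω _).2, mul_zero, Finset.sum_const_zero]
  have heq := Finset.eq_of_subset_of_card_le hsub (by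
    rw [Finset.card_image_of_injective _ hS, Finset.card_univ, Fintype.card_pi_const]
    exact (Multiset.toFinset_card_le _).trans ((Polynomial.card_roots' _).trans hdeg))
  have hxm : x ∈ P.roots.toFinset := by
    rw [Multiset.mem_toFinset, Polynomial.mem_roots hP0, Polynomial.IsRoot, hPe, hx]
  rw [← heq] at hxm
  obtain ⟨c, _, hc⟩ := Finset.mem_image.mp hxm
  exact ⟨c, hc.symm⟩

theorem exists_step (y : ρ.tateModule) : ∃ (c : Fin ρ.rank → Fq) (z : ρ.tateModule),
    y = ∑ i, (PowerSeries.C (c i)) • ρ.tateVec ω i + (PowerSeries.X : PowerSeries Fq) • z := by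
  obtain ⟨c, hc⟩ := ρ.exists_eq_sum_xi_zero ω (ρ.mem_tateModule.mp y.2).1
  set w := y - ∑ i, (PowerSeries.C (c i)) • ρ.tateVec ω i with hw
  have hw0 : PowerSeries.coeff 0 (w : PowerSeries (CInfty Fq)) = 0 := by
    rw [hw, Submodule.coe_sub, map_sub, coeff_sum_smul_tateVec, hc]
    simp
  obtain ⟨_, h1⟩ := ρ.mem_tateModule.mp w.2
  refine ⟨c, ⟨PowerSeries.mk fun m => PowerSeries.coeff (m + 1) (w : PowerSeries (CInfty Fq)),
    ρ.mem_tateModule.mpr ⟨?_, fun m => ?_⟩⟩, ?_⟩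
  · rw [PowerSeries.coeff_mk, h1, hw0]
  · rw [PowerSeries.coeff_mk, PowerSeries.coeff_mk, h1]
  · rw [← sub_eq_iff_eq_add', ← hw]
    apply Subtype.ext
    rw [Submodule.coe_smul]
    ext m
    rw [coeff_smul]
    cases m with
    | zero => simp [hw0]
    | succ m =>
      rw [Finset.Nat.sum_antidiagonal_succ, Finset.sum_eq_single (0, m)]
      · simp
      · rintro ⟨p, r⟩ hp hne
        rw [Finset.HasAntidiagonal.mem_antidiagonal] at hp
        have hp0 : p ≠ 0 := by
          rintro rfl
          exact hne (by simpa using hp)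
        simp [PowerSeries.coeff_X, hp0]
      · intro h; simp at h

theorem tateVec_span : ⊤ ≤ Submodule.span (PowerSeries Fq) (Set.range (ρ.tateVec ω)) := by
  intro y _
  choose c z hz using ρ.exists_step ω
  let s : ℕ → ρ.tateModule := fun n => z^[n] y
  let A : Fin ρ.rank → PowerSeries Fq := fun i => PowerSeries.mk fun n => c (s n) i
  have key : ∀ n, y = ∑ i, (PowerSeries.trunc n (A i) : PowerSeries Fq) • ρ.tateVec ω i +
      (PowerSeries.X ^ n : PowerSeries Fq) • s n := by
    intro n
    induction n with
    | zero => simp [s]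
    | succ n ih =>
      have h1 : s (n + 1) = z (s n) := Function.iterate_succ_apply' _ _ _
      have h2 := hz (s n)
      conv_lhs => rw [ih, h2]
      rw [h1, smul_add, Finset.smul_sum, ← add_assoc, ← Finset.sum_add_distrib, smul_smul,
        ← pow_succ]
      congr 1
      refine Finset.sum_congr rfl fun i _ => ?_
      rw [smul_smul, ← add_smul, PowerSeries.trunc_succ]
      congr 1
      rw [Polynomial.coe_add, Polynomial.coe_monomial, PowerSeries.coeff_mk]
      congr 1
      rw [PowerSeries.monomial_eq_C_mul_X_pow, mul_comm]
  have hy : y = ∑ i, A i • ρ.tateVec ω i := by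
    apply Subtype.ext
    ext m
    have h1 := congrArg (fun f : ρ.tateModule =>
      PowerSeries.coeff m (f : PowerSeries (CInfty Fq))) (key (m + 1))
    simp only [Submodule.coe_add, map_add] at h1
    rw [h1, coeff_sum_smul_tateVec, coeff_sum_smul_tateVec, Submodule.coe_smul, coeff_smul]
    rw [Finset.sum_eq_zero (s := Finset.HasAntidiagonal.antidiagonal m), add_zero]
    · refine Finset.sum_congr rfl fun i _ => Finset.sum_congr rfl fun p hp => ?_
      rw [Finset.HasAntidiagonal.mem_antidiagonal] at hp
      rw [Polynomial.coeff_coe, PowerSeries.coeff_trunc, if_pos (by omega)]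
    · intro p hp
      rw [Finset.HasAntidiagonal.mem_antidiagonal] at hp
      rw [PowerSeries.coeff_X_pow, if_neg (by omega), map_zero, zero_mul]
  rw [hy]
  exact Submodule.sum_mem _ fun i _ => Submodule.smul_mem _ _ (Submodule.subset_span ⟨i, rfl⟩)

/-- The `F_q[[t]]`-basis `x_1, …, x_r` of `T_t(ρ)` attached to an `A`-basis of `Λ_ρ`. -/
def tateBasis : Module.Basis (Fin ρ.rank) (PowerSeries Fq) ρ.tateModule :=
  Module.Basis.mk (ρ.tateVec_linearIndependent ω) (ρ.tateVec_span ω)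

/-- The matrix `g_ε ∈ GL_r(F_q[[t]])` of `φ_t(ε)` in the basis `x_1, …, x_r`, in the convention
`φ_t(ε) x_i = ∑_j (g_ε)_ij x_j`. -/
def galoisMatrix (hρ : ρ.IsDefinedOver K) (ε : KSep K ≃ₐ[K] KSep K) :
    GL (Fin ρ.rank) (PowerSeries Fq) where
  val := (LinearMap.toMatrix (ρ.tateBasis ω) (ρ.tateBasis ω) (ρ.galoisRep K hρ ε)).transpose
  inv := (LinearMap.toMatrix (ρ.tateBasis ω) (ρ.tateBasis ω) (ρ.galoisRep K hρ ε⁻¹)).transpose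
  val_inv := by
    rw [← Matrix.transpose_mul, ← LinearMap.toMatrix_mul, ← map_mul, inv_mul_cancel, map_one,
      LinearMap.toMatrix_one, Matrix.transpose_one]
  inv_val := by
    rw [← Matrix.transpose_mul, ← LinearMap.toMatrix_mul, ← map_mul, mul_inv_cancel, map_one,
      LinearMap.toMatrix_one, Matrix.transpose_one]

theorem galoisRep_tateBasis (hρ : ρ.IsDefinedOver K) (ε : KSep K ≃ₐ[K] KSep K) (i : Fin ρ.rank) :
    ρ.galoisRep K hρ ε (ρ.tateBasis ω i) =
      ∑ j, ρ.galoisMatrix K ω hρ ε i j • ρ.tateBasis ω j := by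
  conv_lhs => rw [← (ρ.tateBasis ω).sum_repr (ρ.galoisRep K hρ ε (ρ.tateBasis ω i))]
  refine Finset.sum_congr rfl fun j _ => ?_
  congr 1
  change _ = LinearMap.toMatrix _ _ _ j i
  rw [LinearMap.toMatrix_apply]

end DrinfeldModule

end

/-! The idea is that Galois conjugates of `Ψ_ρ` are again points of `Z_{Ψ_ρ}`, and that they differ
from `Ψ_ρ` by the matrices `g_ε`.

Extend `ε` to an automorphism `σ` of `\overline k` over `K` and let it act on the coefficients of
Laurent series in `t`. The coefficients of `f_i` are the torsion points forming `x_i`, so the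
relation `φ_t(ε) x_i = ∑_j (g_ε)_ij x_j` says that `σ` multiplies the column of the `f_i` by `g_ε`
on the left. Twisting preserves this, because `g_ε` has entries in `F_q[[t]]`; hence `σ(Υ^(1)) = g_ε
Υ^(1)` (`exists_upsilonTwist_descent`). The entries of `V` are `q ^ j`-th roots of elements of `K`.
Such roots are unique in characteristic `p`, so `σ` fixes `V` (`exists_matV_descent`). Together
these give `σ(Ψ_ρ) = Ψ_ρ g_ε⁻¹` (`exists_psi_descent`).

Since `Z_{Ψ_ρ}` is cut out by equations over `K(t)`, which `σ` fixes, `Ψ_ρ g_ε⁻¹` satisfies every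
equation that `Ψ_ρ` does. Thus `g_ε⁻¹ = Ψ_ρ⁻¹ (Ψ_ρ g_ε⁻¹)` lies in `Ψ_ρ⁻¹ Z_{Ψ_ρ}`, as a point over
`ℂ_∞((t))`. But `Γ_{Ψ_ρ}` is defined through points over the algebraic closure of `𝕃`. The gap is
closed by the Nullstellensatz (`inv_mul_mem_points_idealGamma`): an equation failing at a point over
some extension field of `𝕃` already fails at a point over the algebraic closure. So `g_ε⁻¹` lies on
`Γ_{Ψ_ρ}` (`inv_galoisMatrix_mem`), and replacing `ε` by `ε⁻¹` gives the theorem without using that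
`Γ_{Ψ_ρ}` is a group.

As `σ` is not assumed continuous, it is never extended to `ℂ_∞`. Its action is recorded by comparing
two embeddings of `\overline k((t))` into `ℂ_∞((t))`, induced by the inclusion `\overline k ⊆ ℂ_∞`
and by its composite with `σ`. -/

noncomputable section

/-! ### Evaluation on the coordinate ring of `GL_n` and change of rings -/

namespace GLCoord

variable {R S S' : Type*} [CommRing R] [CommRing S] [CommRing S'] {n : ℕ}

theorem eval_algebraMap (φ : R →+* S) (g : GL (Fin n) S) (p : MvPolynomial (Fin n × Fin n) R) :
    eval φ g (algebraMap _ _ p) = MvPolynomial.eval₂ φ (fun p : Fin n × Fin n => g p.1 p.2) p :=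
  IsLocalization.Away.lift_eq _ _ _

/-- Both sides are ring homomorphisms in `h`, so they need only be compared on constants and on the
coordinates `X_ij`. This is the tool that carries an equation satisfied by a matrix along a
homomorphism, in particular along the conjugate embedding. -/
theorem map_eval (f : S →+* S') (φ : R →+* S) (g : GL (Fin n) S) (h : GLCoord R n) :
    f (eval φ g h) = eval (f.comp φ) (Matrix.GeneralLinearGroup.map f g) h := by
  suffices H : f.comp (eval φ g) = eval (f.comp φ) (Matrix.GeneralLinearGroup.map f g) from
    RingHom.congr_fun H h
  refine IsLocalization.ringHom_ext (Submonoid.powers (Matrix.mvPolynomialX (Fin n) (Fin n) R).det)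
    (MvPolynomial.ringHom_ext (fun r => ?_) fun p => ?_)
  · simp only [RingHom.comp_apply, eval_algebraMap, MvPolynomial.eval₂_C]
  · simp only [RingHom.comp_apply, eval_algebraMap, MvPolynomial.eval₂_X,
      Matrix.GeneralLinearGroup.map_apply]

/-- This makes the hypothesis that `Z` is defined over `K(t)` usable: the generators of its ideal
can be evaluated directly from `K(t)`, where `σ` acts trivially. -/
theorem eval_baseChange (χ : R →+* S) (φ : S →+* S') (g : GL (Fin n) S') (h : GLCoord R n) :
    eval φ g (baseChange χ h) = eval (φ.comp χ) g h := by
  suffices H : (eval φ g).comp (baseChange χ) = eval (φ.comp χ) g from RingHom.congr_fun H h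
  have hb : ∀ p, baseChange (n := n) χ (algebraMap _ _ p) =
      algebraMap _ _ (MvPolynomial.map χ p) := fun p => IsLocalization.Away.lift_eq _ _ _
  refine IsLocalization.ringHom_ext (Submonoid.powers (Matrix.mvPolynomialX (Fin n) (Fin n) R).det)
    (MvPolynomial.ringHom_ext (fun r => ?_) fun p => ?_)
  · simp only [RingHom.comp_apply, hb, eval_algebraMap, MvPolynomial.eval₂_C, MvPolynomial.map_C]
  · simp only [RingHom.comp_apply, hb, eval_algebraMap, MvPolynomial.eval₂_X, MvPolynomial.map_X]

end GLCoord

/-! ### Nullstellensatz: from the algebraic closure of `L` to arbitrary extension fields -/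

/-- Every nonzero finitely generated algebra over a field `L` has a point over the algebraic closure
of `L`. -/
theorem exists_algHom_algebraicClosure (L B : Type*) [Field L] [CommRing B] [Nontrivial B]
    [Algebra L B] [Algebra.FiniteType L B] : Nonempty (B →ₐ[L] AlgebraicClosure L) := by
  obtain ⟨m, hm⟩ := Ideal.exists_maximal B
  let := Ideal.Quotient.field m
  have : Algebra.FiniteType L (B ⧸ m) := inferInstance
  -- Zariski's lemma: a field that is finitely generated as an `L`-algebra is finite over `L`, hence
  -- embeds in the algebraic closure.
  have : Module.Finite L (B ⧸ m) := finite_of_finite_type_of_isJacobsonRing L (B ⧸ m)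
  exact ⟨(IsAlgClosed.lift : (B ⧸ m) →ₐ[L] AlgebraicClosure L).comp (Ideal.Quotient.mkₐ L m)⟩

/-- Nullstellensatz: the points of `Ψ⁻¹ Z_Ψ` over any extension field of `L` lie on `Γ_Ψ`. -/
theorem inv_mul_mem_points_idealGamma {F K L N : Type*} [Field F] [Field K] [Field L] [Field N]
    {n : ℕ} (ψ : F →+* K) (φ : K →+* L) (j : L →+* N) (Ψ : GL (Fin n) L) (z : GL (Fin n) N)
    (hz : z ∈ GLCoord.points (j.comp φ) (idealZ φ Ψ)) :
    (Matrix.GeneralLinearGroup.map j Ψ)⁻¹ * z ∈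
      GLCoord.points ((j.comp φ).comp ψ) (idealGamma ψ φ Ψ) := by
  intro h hh
  classical
  by_contra hw
  set w := GLCoord.eval ((j.comp φ).comp ψ) ((Matrix.GeneralLinearGroup.map j Ψ)⁻¹ * z) h with hwdef
  let := j.toAlgebra
  -- The entries of `z` and `z⁻¹` make `z` an element of `GL_n(B)`. Adjoining `w⁻¹` makes the
  -- supposedly nonzero value `w` a unit of `B`, so that no specialisation of `B` to a field can
  -- kill it. The entries of `Ψ` already lie in `L`.
  let s : Finset N := Finset.univ.image (fun p : Fin n × Fin n => z p.1 p.2) ∪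
    Finset.univ.image (fun p : Fin n × Fin n => (z⁻¹) p.1 p.2) ∪ {w⁻¹}
  let B : Subalgebra L N := Algebra.adjoin L (s : Set N)
  have : Algebra.FiniteType L B := (Subalgebra.fg_iff_finiteType B).mp ⟨s, rfl⟩
  have hs : ∀ x ∈ s, x ∈ B := fun x hx => Algebra.subset_adjoin hx
  have h1 : ∀ a b, z a b ∈ B := fun a b => hs _ (by
    simpa [s] using Or.inr (Or.inl ⟨a, b, rfl⟩))
  have h2 : ∀ a b, (z⁻¹) a b ∈ B := fun a b => hs _ (by
    simpa [s] using Or.inr (Or.inr ⟨a, b, rfl⟩))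
  have h3 : w⁻¹ ∈ B := hs _ (by simp [s])
  let i : B →+* N := B.val.toRingHom
  have hi : Function.Injective i := Subtype.val_injective
  let zB : GL (Fin n) B :=
    { val := Matrix.of fun a b => ⟨z a b, h1 a b⟩
      inv := Matrix.of fun a b => ⟨(z⁻¹) a b, h2 a b⟩
      val_inv := by
        refine Matrix.map_injective hi ?_
        simp only [Matrix.map_mul, Matrix.map_one i (map_zero i) (map_one i)]
        exact z.val_inv
      inv_val := by
        refine Matrix.map_injective hi ?_
        simp only [Matrix.map_mul, Matrix.map_one i (map_zero i) (map_one i)]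
        exact z.inv_val }
  have hzB : Matrix.GeneralLinearGroup.map i zB = z := by ext a b; rfl
  -- The homomorphism `f` specialises `z` to a point over the algebraic closure of `L` without
  -- moving `Ψ`, since it is `L`-linear.
  obtain ⟨f⟩ := exists_algHom_algebraicClosure L B
  let c : L →+* B := algebraMap L B
  have hfc : f.toRingHom.comp c = algebraMap L (AlgebraicClosure L) := f.comp_algebraMap
  have hic : i.comp c = j := rfl
  let wB := GLCoord.eval ((c.comp φ).comp ψ) ((Matrix.GeneralLinearGroup.map c Ψ)⁻¹ * zB) h
  have hiw : i wB = w := by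
    simp only [wB, GLCoord.map_eval, map_mul, map_inv, hzB, hwdef]
    rfl
  have hunit : wB * ⟨w⁻¹, h3⟩ = 1 := hi (by
    rw [map_mul, hiw, map_one]; exact mul_inv_cancel₀ hw)
  -- The equations of `Z_Ψ` vanish at `z` in `N`, hence in the subring `B`, hence after applying
  -- `f`.
  have hmem : Matrix.GeneralLinearGroup.map f.toRingHom zB ∈
      GLCoord.points ((algebraMap L (AlgebraicClosure L)).comp φ) (idealZ φ Ψ) := by
    intro p hp
    have hp0 : GLCoord.eval (c.comp φ) zB p = 0 := hi (by
      rw [GLCoord.map_eval, hzB, map_zero]; exact hz p hp)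
    rw [← hfc, RingHom.comp_assoc, ← GLCoord.map_eval, hp0, map_zero]
  -- The ideal of `Γ_Ψ` is an intersection over the points of `Z_Ψ`, and the specialised `z` is one
  -- of them. So `h` vanishes there, which forces `f` to kill the unit `w`.
  have hker := (Submodule.mem_iInf _).mp ((Submodule.mem_iInf _).mp hh _) hmem
  have hf0 : f.toRingHom wB = 0 := by
    rw [GLCoord.map_eval, map_mul, map_inv, ← RingHom.comp_assoc, ← RingHom.comp_assoc, hfc]
    have e : Matrix.GeneralLinearGroup.map f.toRingHom (Matrix.GeneralLinearGroup.map c Ψ) =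
        Matrix.GeneralLinearGroup.map (algebraMap L (AlgebraicClosure L)) Ψ := by
      rw [← hfc]; rfl
    rw [e]
    exact hker
  have := congrArg f.toRingHom hunit
  rw [map_mul, hf0, zero_mul, map_one] at this
  exact zero_ne_one this

end
-- Laurent series over a varying coefficient field, and the embedding of `𝕃`
noncomputable section

/-- The homomorphism `E((t)) → E'((t))` induced by a homomorphism of fields `E → E'`. -/
def laurentMap {E E' : Type*} [Field E] [Field E'] (f : E →+* E') :
    LaurentSeries E →+* LaurentSeries E' :=
  IsFractionRing.lift (A := PowerSeries E)
    (g := (algebraMap (PowerSeries E') (LaurentSeries E')).comp (PowerSeries.map f))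
    ((IsFractionRing.injective (PowerSeries E') (LaurentSeries E')).comp
      (PowerSeries.map_injective f f.injective))

section laurentMap

variable {E E' E'' : Type*} [Field E] [Field E'] [Field E'']

theorem laurentMap_algebraMap (f : E →+* E') (p : PowerSeries E) :
    laurentMap f (algebraMap (PowerSeries E) (LaurentSeries E) p) =
      algebraMap (PowerSeries E') (LaurentSeries E') (PowerSeries.map f p) :=
  IsFractionRing.lift_algebraMap _ p

theorem laurentMap_comp (f : E →+* E') (g : E' →+* E'') :
    (laurentMap g).comp (laurentMap f) = laurentMap (g.comp f) := by
  refine IsLocalization.ringHom_ext (nonZeroDivisors (PowerSeries E)) (RingHom.ext fun p => ?_)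
  simp only [RingHom.comp_apply, laurentMap_algebraMap, PowerSeries.map_comp]

theorem ratFuncToLaurent_algebraMap (p : Polynomial E) :
    ratFuncToLaurent E (algebraMap _ _ p) =
      algebraMap (PowerSeries E) (LaurentSeries E) (p : PowerSeries E) := by
  rw [ratFuncToLaurent, RatFunc.liftRingHom_algebraMap]; rfl

theorem ratFuncMap_algebraMap (f : E →+* E') (p : Polynomial E) :
    ratFuncMap f (algebraMap _ _ p) = algebraMap _ (RatFunc E') (p.map f) := by
  have := RatFunc.map_apply_div (Polynomial.mapRingHom f)
    (nonZeroDivisors_le_comap_nonZeroDivisors_of_injective _ (Polynomial.map_injective f f.injective)) p 1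
  simpa [ratFuncMap, RatFunc.coe_mapRingHom_eq_coe_map] using this

/-- Two homomorphisms out of a fraction field agree once they agree on polynomials, where both act
on coefficients. Consequently two embeddings of `\overline k` that agree on `K` induce maps of
Laurent series that agree on `K(t)`. -/
theorem laurentMap_comp_ratFuncToLaurent (f : E →+* E') :
    (laurentMap f).comp (ratFuncToLaurent E) = (ratFuncToLaurent E').comp (ratFuncMap f) := by
  refine IsLocalization.ringHom_ext (nonZeroDivisors (Polynomial E)) (RingHom.ext fun p => ?_)
  simp only [RingHom.comp_apply, ratFuncMap_algebraMap, ratFuncToLaurent_algebraMap,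
    laurentMap_algebraMap, Polynomial.polynomial_map_coe]

end laurentMap

/-- The inclusion `𝕃 ⊆ ℂ_∞((t))`. -/
def llToLaurent (Fq : Type*) [Field Fq] [Fintype Fq] : LL Fq →+* LaurentSeries (CInfty Fq) :=
  IsFractionRing.lift (A := TateAlg Fq)
    (g := (algebraMap (PowerSeries (CInfty Fq)) (LaurentSeries (CInfty Fq))).comp
      (TateAlg Fq).subtype)
    ((IsFractionRing.injective (PowerSeries (CInfty Fq)) (LaurentSeries (CInfty Fq))).comp
      (TateAlg Fq).subtype_injective)

theorem llToLaurent_algebraMap {Fq : Type*} [Field Fq] [Fintype Fq] (f : TateAlg Fq) :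
    llToLaurent Fq (algebraMap _ _ f) =
      algebraMap (PowerSeries (CInfty Fq)) (LaurentSeries (CInfty Fq)) f :=
  IsFractionRing.lift_algebraMap _ f

/-- The definition of `Z_{Ψ_ρ}` uses the route through `𝕃`, whereas Galois conjugation takes place
in `\overline k((t))`. This compatibility allows passing from one to the other. -/
theorem llToLaurent_comp_ratFuncToLL (Fq : Type*) [Field Fq] [Fintype Fq] :
    (llToLaurent Fq).comp (ratFuncToLL Fq) =
      (laurentMap (algebraMap (KBar Fq) (CInfty Fq))).comp (ratFuncToLaurent (KBar Fq)) := by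
  refine IsLocalization.ringHom_ext (nonZeroDivisors (Polynomial (KBar Fq)))
    (RingHom.ext fun p => ?_)
  simp only [RingHom.comp_apply, ratFuncToLaurent_algebraMap, laurentMap_algebraMap]
  rw [ratFuncToLL, RatFunc.liftRingHom_algebraMap, RingHom.comp_apply,
    llToLaurent_algebraMap, TateAlg.coe_ofPoly, Polynomial.polynomial_map_coe]

/-- A field embedding is injective on determinants, so invertibility over the larger field descends
to the matrix over the smaller one. -/
theorem Matrix.GeneralLinearGroup.exists_map_eq {M N : Type*} [Field M] [Field N] {n : ℕ}
    (i : M →+* N) (A : Matrix (Fin n) (Fin n) M) (g : GL (Fin n) N)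
    (h : A.map i = (g : Matrix (Fin n) (Fin n) N)) :
    ∃ v : GL (Fin n) M, (v : Matrix (Fin n) (Fin n) M) = A ∧
      Matrix.GeneralLinearGroup.map i v = g := by
  have hdet : A.det ≠ 0 := by
    intro h0
    have h1 := i.map_det A
    rw [h0, map_zero, RingHom.mapMatrix_apply, h] at h1
    exact ((Matrix.isUnit_iff_isUnit_det _).mp g.isUnit).ne_zero h1.symm
  exact ⟨Matrix.GeneralLinearGroup.mkOfDetNeZero A hdet, rfl, Units.ext h⟩

/-! ### Roots under powers of the Frobenius -/

namespace CInfty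

variable {Fq : Type*} [Field Fq] [Fintype Fq]

theorem pow_card_pow_injective (n : ℕ) :
    Function.Injective fun x : CInfty Fq => x ^ (Fintype.card Fq) ^ n := by
  intro x y h
  simp only [← frob_pow_apply] at h
  exact (frob Fq ^ n).injective h

/-- Together with injectivity of the `q ^ n`-power map, this characterises the negative twist of a
constant as its unique `q ^ n`-th root, so entries of `V` can be recognised by their powers. -/
theorem frobEquiv_symm_pow_pow (n : ℕ) (x : CInfty Fq) :
    (((frobEquiv Fq).symm ^ n) x) ^ (Fintype.card Fq) ^ n = x := by
  induction n generalizing x with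
  | zero => simp
  | succ n ih =>
    rw [pow_succ', pow_succ, pow_mul, RingAut.mul_apply]
    have h : ∀ y : CInfty Fq, (((frobEquiv Fq).symm y)) ^ Fintype.card Fq = y := fun y =>
      (frobEquiv Fq).apply_symm_apply y
    rw [← pow_mul, mul_comm, pow_mul, h, ih]

end CInfty

/-! ### Descent of `V` and `Υ^(1)` to `\overline k`, with the Galois action -/

namespace DrinfeldModule

variable {Fq : Type*} [Field Fq] [Fintype Fq] (ρ : DrinfeldModule Fq)
  (K : IntermediateField (RatFunc Fq) (KBar Fq))
  (ω : Module.Basis (Fin ρ.rank) (Polynomial Fq) ρ.periodLattice)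

/-- The matrix `V` has coefficients in the perfect closure of `K`. -/
theorem exists_matV_descent (hρ : ρ.IsDefinedOver K) :
    ∃ v : Matrix (Fin ρ.rank) (Fin ρ.rank) (KBar Fq),
      v.map (algebraMap (KBar Fq) (CInfty Fq)) = ρ.matV ∧
      ∀ σ : KBar Fq ≃ₐ[K] KBar Fq, v.map σ = v := by
  have : IsAlgClosed (KBar Fq) := (algebraicClosure.isAlgClosure (F := RatFunc Fq)
    (E := KInftyBar Fq)).isAlgClosed
  choose c hc using hρ Polynomial.X
  -- The roots are taken in `\overline k` rather than `K^sep`, because they may be inseparable over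
  -- `K`.
  have hroot : ∀ i j : Fin ρ.rank, ∃ y : KBar Fq,
      y ^ (Fintype.card Fq) ^ (j : ℕ) = algebraMap K (KBar Fq) (c (i + j + 1)) := fun i j =>
    IsAlgClosed.exists_pow_nat_eq _ (pow_pos Fintype.card_pos _)
  choose v hv using hroot
  refine ⟨Matrix.of v, ?_, fun σ => ?_⟩
  · ext i j
    -- After raising to the power `q ^ j`, the chosen root and the entry of `V` both become the
    -- coefficient `κ_{i+j+1}`.
    refine CInfty.pow_card_pow_injective (j : ℕ) ?_
    simp only [Matrix.map_apply, Matrix.of_apply, matV]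
    rw [CInfty.frobEquiv_symm_pow_pow, ← map_pow, hv]
    exact (hc _).symm
  · ext i j
    -- The entry and its conjugate have the same `q ^ j`-th power, an element of `K` fixed by `σ`;
    -- uniqueness of the root makes them equal.
    refine congrArg Subtype.val ((algebraMap (KBar Fq) (CInfty Fq)).injective
      (CInfty.pow_card_pow_injective (j : ℕ) ?_))
    simp only [Matrix.map_apply, Matrix.of_apply, ← map_pow, hv, AlgEquiv.commutes]

/-- The matrix `Υ^(1)` has coefficients in `\overline k`, and every extension `σ` of `ε` acts on it as
left multiplication by the matrix of `φ_t(ε)`. -/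
theorem exists_upsilonTwist_descent (hρ : ρ.IsDefinedOver K) (ε : KSep K ≃ₐ[K] KSep K)
    (σ : KBar Fq ≃ₐ[K] KBar Fq) (hσ : ∀ y : KSep K, σ y = ε y) :
    ∃ u : Matrix (Fin ρ.rank) (Fin ρ.rank) (PowerSeries (KBar Fq)),
      u.map (PowerSeries.map (algebraMap (KBar Fq) (CInfty Fq))) =
        (ρ.upsilonTwist ω).map Subtype.val ∧
      u.map (PowerSeries.map ((algebraMap (KBar Fq) (CInfty Fq)).comp (σ : KBar Fq →+* KBar Fq))) =
        ((ρ.galoisMatrix K ω hρ ε).val.map (PowerSeries.map (algebraMap Fq (CInfty Fq)))) *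
          (ρ.upsilonTwist ω).map Subtype.val := by
  -- The exponent is `j + 1` because column `j`, counted from `0`, is twisted `j` times in `Υ` and
  -- once more in `Υ^(1)`.
  have htw : ∀ i j m, PowerSeries.coeff m (ρ.upsilonTwist ω i j : PowerSeries (CInfty Fq)) =
      PowerSeries.coeff m (ρ.tateBasis ω i : PowerSeries (CInfty Fq)) ^
        (Fintype.card Fq) ^ ((j : ℕ) + 1) := by
    intro i j m
    have h : (ρ.upsilonTwist ω i j : PowerSeries (CInfty Fq)) =
        PowerSeries.map (CInfty.frob Fq ^ 1) (PowerSeries.map (CInfty.frob Fq ^ (j : ℕ))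
          (PowerSeries.mk (ρ.xi (ω i)))) := rfl
    have hb : (ρ.tateBasis ω i : PowerSeries (CInfty Fq)) = PowerSeries.mk (ρ.xi (ω i)) := by
      rw [tateBasis, Module.Basis.mk_apply]; rfl
    rw [h, hb, PowerSeries.coeff_map, PowerSeries.coeff_map, CInfty.frob_pow_apply,
      CInfty.frob_pow_apply, ← pow_mul, ← pow_add]
  -- The coefficients of the descended matrix are `q ^ (j + 1)`-th powers of torsion points, lifted
  -- from `ℂ_∞` to `K^sep`.
  refine ⟨Matrix.of fun i (j : Fin ρ.rank) => PowerSeries.mk fun m =>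
    ((PowerSeries.coeff m (ρ.sepSeries K hρ (ρ.tateBasis ω i)) : KSep K) : KBar Fq) ^
      (Fintype.card Fq) ^ ((j : ℕ) + 1), ?_, ?_⟩
  · ext i j m
    simp only [Matrix.map_apply, Matrix.of_apply, PowerSeries.coeff_map, PowerSeries.coeff_mk,
      map_pow, htw]
    congr 1
    exact ρ.coeff_sepSeries K hρ _ m
  · have hW : ∀ i (j : Fin ρ.rank), (ρ.upsilonTwist ω i j : PowerSeries (CInfty Fq)) =
        PowerSeries.map (CInfty.frob Fq ^ ((j : ℕ) + 1)) (ρ.tateBasis ω i) := fun i j => by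
      ext m
      rw [htw, PowerSeries.coeff_map, CInfty.frob_pow_apply]
    ext1 i j
    -- Conjugation commutes with `q`-powers, and on the torsion points, which lie in `K^sep`, `σ` is
    -- `ε`. So conjugating an entry gives the twist of `φ_t(ε) x_i`.
    have h1 : (Matrix.map (Matrix.of fun i (j : Fin ρ.rank) => PowerSeries.mk fun m =>
        ((PowerSeries.coeff m (ρ.sepSeries K hρ (ρ.tateBasis ω i)) : KSep K) : KBar Fq) ^
        (Fintype.card Fq) ^ ((j : ℕ) + 1)) (PowerSeries.map
          ((algebraMap (KBar Fq) (CInfty Fq)).comp (σ : KBar Fq →+* KBar Fq)))) i j =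
        PowerSeries.map (CInfty.frob Fq ^ ((j : ℕ) + 1))
          (ρ.galoisRep K hρ ε (ρ.tateBasis ω i) : PowerSeries (CInfty Fq)) := by
      ext m
      rw [PowerSeries.coeff_map _ m, CInfty.frob_pow_apply,
        ρ.coeff_galoisRep K hρ ε _ m _ (ρ.coeff_sepSeries K hρ _ m)]
      simp only [Matrix.map_apply, Matrix.of_apply, PowerSeries.coeff_map, PowerSeries.coeff_mk,
        map_pow, RingHom.comp_apply]
      exact congrArg (fun y => algebraMap (KBar Fq) (CInfty Fq) y ^ _) (hσ _)
    -- The scalars `g_ij` have coefficients in `F_q`, hence survive twisting unchanged; the relation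
    -- between the `x_i` therefore holds in every column with the same matrix.
    have h2 : ∀ a : PowerSeries Fq, PowerSeries.map (CInfty.frob Fq ^ ((j : ℕ) + 1))
        (algebraMap (PowerSeries Fq) (PowerSeries (CInfty Fq)) a) =
        PowerSeries.map (algebraMap Fq (CInfty Fq)) a := by
      intro a
      ext m
      rw [PowerSeries.coeff_map, PowerSeries.coeff_map, CInfty.frob_pow_apply]
      exact CInfty.algebraMap_pow_card_pow _ _
    rw [h1, galoisRep_tateBasis, Submodule.coe_sum, map_sum, Matrix.mul_apply]
    refine Finset.sum_congr rfl fun k _ => ?_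
    rw [Submodule.coe_smul, Algebra.smul_def, map_mul, h2, Matrix.map_apply, Matrix.map_apply, hW]

end DrinfeldModule

end
-- The Galois conjugates of `Ψ_ρ`
noncomputable section
namespace DrinfeldModule

variable {Fq : Type*} [Field Fq] [Fintype Fq] (ρ : DrinfeldModule Fq)
  (K : IntermediateField (RatFunc Fq) (KBar Fq))
  (ω : Module.Basis (Fin ρ.rank) (Polynomial Fq) ρ.periodLattice)

/-- The matrix of `φ_t(ε)` in `GL_r(F_q((t)))`. -/
abbrev galoisMatrixLaurent (hρ : ρ.IsDefinedOver K) (ε : KSep K ≃ₐ[K] KSep K) :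
    GL (Fin ρ.rank) (LaurentSeries Fq) :=
  Matrix.GeneralLinearGroup.map (algebraMap (PowerSeries Fq) (LaurentSeries Fq))
    (ρ.galoisMatrix K ω hρ ε)

/-- The matrix of `ε⁻¹` was chosen as the inverse in the construction of the unit `g_ε`, so this
holds by definition. -/
theorem galoisMatrix_inv (hρ : ρ.IsDefinedOver K) (ε : KSep K ≃ₐ[K] KSep K) :
    ρ.galoisMatrix K ω hρ ε⁻¹ = (ρ.galoisMatrix K ω hρ ε)⁻¹ :=
  Units.ext rfl

/-- `Ψ_ρ` has coefficients in `\overline k((t))`, where every extension `σ` of `ε` acts on it as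
right multiplication by the inverse of the matrix of `φ_t(ε)`. -/
theorem exists_psi_descent (hρ : ρ.IsDefinedOver K) (ε : KSep K ≃ₐ[K] KSep K)
    (σ : KBar Fq ≃ₐ[K] KBar Fq) (hσ : ∀ y : KSep K, σ y = ε y) :
    ∃ P : GL (Fin ρ.rank) (LaurentSeries (KBar Fq)),
      Matrix.GeneralLinearGroup.map (laurentMap (algebraMap (KBar Fq) (CInfty Fq))) P =
        Matrix.GeneralLinearGroup.map (llToLaurent Fq) (ρ.psi ω) ∧
      Matrix.GeneralLinearGroup.map
          (laurentMap ((algebraMap (KBar Fq) (CInfty Fq)).comp (σ : KBar Fq →+* KBar Fq))) P =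
        Matrix.GeneralLinearGroup.map (llToLaurent Fq) (ρ.psi ω) *
          (Matrix.GeneralLinearGroup.map (laurentMap (algebraMap Fq (CInfty Fq)))
            (ρ.galoisMatrixLaurent K ω hρ ε))⁻¹ := by
  obtain ⟨v, hv, hvσ⟩ := ρ.exists_matV_descent K hρ
  obtain ⟨u, hu, huσ⟩ := ρ.exists_upsilonTwist_descent K ω hρ ε σ hσ
  set Vl := Matrix.GeneralLinearGroup.mkOfDetNeZero
    (((algebraMap (TateAlg Fq) (LL Fq)).comp (TateAlg.const Fq)).mapMatrix ρ.matV) (by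
      rw [← RingHom.map_det]
      exact (map_ne_zero _).mpr ρ.matV_det_ne_zero) with hVl
  set Ul := Matrix.GeneralLinearGroup.mkOfDetNeZero
    ((algebraMap (TateAlg Fq) (LL Fq)).mapMatrix (ρ.upsilonTwist ω)) (by
      rw [← RingHom.map_det]
      exact (map_ne_zero_iff _ (IsFractionRing.injective (TateAlg Fq) (LL Fq))).mpr
        (ρ.upsilonTwist_det_ne_zero ω)) with hUl
  have hpsi : ρ.psi ω = Vl⁻¹ * Ul⁻¹ := rfl
  set ι := laurentMap (algebraMap (KBar Fq) (CInfty Fq)) with hι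
  have hVN : ∀ i j, llToLaurent Fq (Vl i j) = algebraMap (PowerSeries (CInfty Fq)) _
      (PowerSeries.C (ρ.matV i j)) := fun i j => llToLaurent_algebraMap _
  have hUN : ∀ i j, llToLaurent Fq (Ul i j) = algebraMap (PowerSeries (CInfty Fq)) _
      (ρ.upsilonTwist ω i j : PowerSeries (CInfty Fq)) := fun i j => llToLaurent_algebraMap _
  -- `V` and `Υ^(1)` are lifted separately to `GL_r` over `\overline k((t))`, since `σ` acts
  -- differently on the two factors of `Ψ_ρ`.
  obtain ⟨V, hV, hVι⟩ := Matrix.GeneralLinearGroup.exists_map_eq ι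
    (v.map fun x => algebraMap (PowerSeries (KBar Fq)) _ (PowerSeries.C x))
    (Matrix.GeneralLinearGroup.map (llToLaurent Fq) Vl) (by
      ext1 i j
      rw [Matrix.map_apply, Matrix.map_apply, Matrix.GeneralLinearGroup.map_apply, hVN, hι,
        laurentMap_algebraMap, PowerSeries.map_C, ← hv, Matrix.map_apply])
  obtain ⟨U, hU, hUι⟩ := Matrix.GeneralLinearGroup.exists_map_eq ι
    (u.map (algebraMap (PowerSeries (KBar Fq)) _))
    (Matrix.GeneralLinearGroup.map (llToLaurent Fq) Ul) (by
      ext1 i j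
      rw [Matrix.map_apply, Matrix.map_apply, Matrix.GeneralLinearGroup.map_apply, hUN, hι,
        laurentMap_algebraMap]
      exact congrArg _ (congrFun (congrFun hu i) j))
  refine ⟨V⁻¹ * U⁻¹, ?_, ?_⟩
  · rw [hpsi, map_mul, map_mul, map_inv, map_inv, map_inv, map_inv, hVι, hUι]
  · have hVσ : Matrix.GeneralLinearGroup.map
        (laurentMap ((algebraMap (KBar Fq) (CInfty Fq)).comp (σ : KBar Fq →+* KBar Fq))) V =
        Matrix.GeneralLinearGroup.map (llToLaurent Fq) Vl := by
      refine Units.ext (Matrix.ext fun i j => ?_)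
      have h := congrFun (congrFun (hvσ σ) i) j
      rw [Matrix.map_apply] at h
      rw [Matrix.GeneralLinearGroup.map_apply, Matrix.GeneralLinearGroup.map_apply, hVN, hV,
        Matrix.map_apply, laurentMap_algebraMap, PowerSeries.map_C, RingHom.comp_apply,
        RingHom.coe_coe, h, ← hv, Matrix.map_apply]
    have hUσ : Matrix.GeneralLinearGroup.map
        (laurentMap ((algebraMap (KBar Fq) (CInfty Fq)).comp (σ : KBar Fq →+* KBar Fq))) U =
        Matrix.GeneralLinearGroup.map (laurentMap (algebraMap Fq (CInfty Fq)))
            (ρ.galoisMatrixLaurent K ω hρ ε) *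
          Matrix.GeneralLinearGroup.map (llToLaurent Fq) Ul := by
      refine Units.ext (Matrix.ext fun i j => ?_)
      rw [Matrix.GeneralLinearGroup.map_apply, hU, Matrix.map_apply, laurentMap_algebraMap]
      refine (congrArg _ (congrFun (congrFun huσ i) j)).trans ?_
      rw [Matrix.GeneralLinearGroup.coe_mul, Matrix.mul_apply, Matrix.mul_apply, map_sum]
      refine Finset.sum_congr rfl fun k _ => ?_
      rw [map_mul, Matrix.GeneralLinearGroup.map_apply, Matrix.GeneralLinearGroup.map_apply,
        Matrix.GeneralLinearGroup.map_apply, hUN, laurentMap_algebraMap]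
      rfl
    -- Inversion turns left multiplication of `Υ^(1)` by `g_ε` into right multiplication by `g_ε⁻¹`:
    -- `V⁻¹ (g_ε Υ^(1))⁻¹ = Ψ_ρ g_ε⁻¹`.
    rw [hpsi, map_mul, map_mul, map_inv, map_inv, map_inv, map_inv, hVσ, hUσ, mul_inv_rev,
      mul_assoc]

/-! ### Conjugates of `Ψ_ρ` on `Z_{Ψ_ρ}`, and the passage to `Γ_{Ψ_ρ}` -/

/-- The inverse of the matrix of `φ_t(ε)` lies on `Γ_{Ψ_ρ}`. -/
theorem inv_galoisMatrix_mem (hρ : ρ.IsDefinedOver K)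
    (hZ : GLCoord.IsDefinedOver (ratFuncMap (algebraMap K (KBar Fq))) (ρ.idealZPsi ω))
    (ε : KSep K ≃ₐ[K] KSep K) :
    (ρ.galoisMatrixLaurent K ω hρ ε)⁻¹ ∈
      GLCoord.points (ratFuncToLaurent Fq) (ρ.idealGammaPsi ω) := by
  have : IsAlgClosed (KBar Fq) := (algebraicClosure.isAlgClosure (F := RatFunc Fq)
    (E := KInftyBar Fq)).isAlgClosed
  have : Algebra.IsAlgebraic K (KBar Fq) := Algebra.IsAlgebraic.tower_top (K := RatFunc Fq) K
  have : Normal K (KBar Fq) := ⟨fun _ => IsAlgClosed.splits _⟩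
  -- Normality of `\overline k / K` provides the extension; an automorphism of `K^sep` alone could
  -- not be applied to the possibly inseparable entries of `V`.
  let σ : KBar Fq ≃ₐ[K] KBar Fq := ε.liftNormal (KBar Fq)
  have hσ : ∀ y : KSep K, σ y = ε y := fun y => ε.liftNormal_commutes (KBar Fq) y
  obtain ⟨P, hP, hPσ⟩ := ρ.exists_psi_descent K ω hρ ε σ hσ
  set Ψ := Matrix.GeneralLinearGroup.map (llToLaurent Fq) (ρ.psi ω) with hΨ
  set G := Matrix.GeneralLinearGroup.map (laurentMap (algebraMap Fq (CInfty Fq)))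
    (ρ.galoisMatrixLaurent K ω hρ ε) with hG
  -- On `K(t)` the conjugate embedding into `ℂ_∞((t))` is the standard one, because `σ` fixes `K`.
  have hcomp : (laurentMap ((algebraMap (KBar Fq) (CInfty Fq)).comp
      (σ : KBar Fq →+* KBar Fq))).comp
        ((ratFuncToLaurent (KBar Fq)).comp (ratFuncMap (algebraMap K (KBar Fq)))) =
      ((llToLaurent Fq).comp (ratFuncToLL Fq)).comp (ratFuncMap (algebraMap K (KBar Fq))) := by
    rw [llToLaurent_comp_ratFuncToLL, RingHom.comp_assoc, ← laurentMap_comp_ratFuncToLaurent,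
      ← RingHom.comp_assoc, ← RingHom.comp_assoc, laurentMap_comp, laurentMap_comp]
    have hK : ((algebraMap (KBar Fq) (CInfty Fq)).comp (σ : KBar Fq →+* KBar Fq)).comp
        (algebraMap K (KBar Fq)) =
        (algebraMap (KBar Fq) (CInfty Fq)).comp (algebraMap K (KBar Fq)) :=
      RingHom.ext fun x => congrArg (algebraMap (KBar Fq) (CInfty Fq)) (σ.commutes x)
    rw [hK]
  obtain ⟨J, hJ⟩ := hZ
  have hz : Ψ * G⁻¹ ∈ GLCoord.points ((llToLaurent Fq).comp (ratFuncToLL Fq))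
      (idealZ (ratFuncToLL Fq) (ρ.psi ω)) := by
    suffices H : ρ.idealZPsi ω ≤
        RingHom.ker (GLCoord.eval ((llToLaurent Fq).comp (ratFuncToLL Fq)) (Ψ * G⁻¹)) from H
    -- Only the generators with coefficients in `K(t)` have to be tested at `Ψ_ρ g_ε⁻¹`.
    rw [hJ, Ideal.map_le_iff_le_comap]
    intro h hh
    have h0 : GLCoord.eval (ratFuncToLL Fq) (ρ.psi ω)
        (GLCoord.baseChange (ratFuncMap (algebraMap K (KBar Fq))) h) = 0 := by
      have : GLCoord.baseChange (ratFuncMap (algebraMap K (KBar Fq))) h ∈ ρ.idealZPsi ω :=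
        hJ ▸ Ideal.mem_map_of_mem _ hh
      exact this
    -- The equation at `Ψ_ρ` is pulled back to its descent `P` over `\overline k((t))` by
    -- injectivity of the inclusion, so that the conjugate embedding can be applied to it next.
    have h1 : GLCoord.eval ((ratFuncToLaurent (KBar Fq)).comp
        (ratFuncMap (algebraMap K (KBar Fq)))) P h = 0 := by
      refine (laurentMap (algebraMap (KBar Fq) (CInfty Fq))).injective ?_
      rw [GLCoord.map_eval, hP, map_zero, ← RingHom.comp_assoc, ← llToLaurent_comp_ratFuncToLL,
        RingHom.comp_assoc, hΨ, ← GLCoord.map_eval, ← GLCoord.eval_baseChange, h0, map_zero]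
    have h2 := congrArg (laurentMap ((algebraMap (KBar Fq) (CInfty Fq)).comp
      (σ : KBar Fq →+* KBar Fq))) h1
    rw [GLCoord.map_eval, hPσ, map_zero] at h2
    rw [hcomp] at h2
    rw [Ideal.mem_comap, RingHom.mem_ker, GLCoord.eval_baseChange, h2]
  -- The Nullstellensatz is applied with `ℂ_∞((t))` as the extension of `𝕃`; in the product `Ψ_ρ⁻¹
  -- (Ψ_ρ g_ε⁻¹)` only `g_ε⁻¹` remains.
  have hmem := inv_mul_mem_points_idealGamma (ratFuncMap (constToKBar Fq)) (ratFuncToLL Fq)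
    (llToLaurent Fq) (ρ.psi ω) _ hz
  rw [← hΨ, inv_mul_cancel_left, llToLaurent_comp_ratFuncToLL, RingHom.comp_assoc,
    ← laurentMap_comp_ratFuncToLaurent, ← RingHom.comp_assoc, laurentMap_comp] at hmem
  intro h hh
  -- The equations have coefficients in `F_q(t)` and the point has entries in `F_q((t))`, so their
  -- vanishing in `ℂ_∞((t))` can be read off in `F_q((t))`.
  refine (laurentMap (algebraMap Fq (CInfty Fq))).injective ?_
  rw [GLCoord.map_eval, map_inv, map_zero]
  exact hmem h hh

end DrinfeldModule

end
theorem theoremT {Fq : Type*} [Field Fq] [Fintype Fq] (ρ : DrinfeldModule Fq)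
    (ω : Module.Basis (Fin ρ.rank) (Polynomial Fq) ρ.periodLattice)
    (K : IntermediateField (RatFunc Fq) (KBar Fq)) [FiniteDimensional (RatFunc Fq) K]
    (hρ : ρ.IsDefinedOver K)
    (hEnd : (ρ.endRing : Set (TwistedPoly Fq)) ⊆ TwistedPoly.over K)
    (hZ : GLCoord.IsDefinedOver (ratFuncMap (algebraMap K (KBar Fq))) (ρ.idealZPsi ω)) :
    ∀ ε : KSep K ≃ₐ[K] KSep K,
      Matrix.GeneralLinearGroup.map (algebraMap (PowerSeries Fq) (LaurentSeries Fq))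
          (ρ.galoisMatrix K ω hρ ε) ∈
        GLCoord.points (ratFuncToLaurent Fq) (ρ.idealGammaPsi ω) := by
  intro ε
  -- Starting from `ε⁻¹` cancels the inverse in `σ(Ψ_ρ) = Ψ_ρ g_ε⁻¹`, so closure of `Γ_{Ψ_ρ}` under
  -- inversion is not needed.
  have h := ρ.inv_galoisMatrix_mem K ω hρ hZ ε⁻¹
  rwa [DrinfeldModule.galoisMatrixLaurent, DrinfeldModule.galoisMatrix_inv, map_inv, inv_inv] at h
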